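/- Let $n,k\in\mathbb N$ and $0<\delta<1$. An $n$-player $k$-action game is a function $g\colon[k]^n\to[0,1]^n$. It is anonymous if $g_i(a)=g_i(b)$ for every player $i$ and all profiles $a,b\in[k]^n$ such that $a_i=b_i$ and every action is taken by the same number of players in $a$ as in $b$. Its Lipschitz constant $\lambda(g)$ is the maximum of $|g_i(a)-g_i(b)|$ over all players $i$ and all profiles $a,b$ with $a_i=b_i$ that differ in exactly one coordinate. The $\delta$-perturbation of $g$ is the game $g^\delta(a)=E[g(A)]$, where $A=(A_1,\dots,A_n)$ has independent coordinates and $A_i$ is distributed according to $(1-\delta)a_i+\delta u$, with $u$ the uniform distribution on $[k]$. Let $\lambda(n,k,\delta)$ be the maximum of $\lambda(g^\delta)$ over all $n$-player $k$-action anonymous games $g$. Then the following hold. (1) For $k\ge 3$, $(1-\delta)^{-1}\sqrt{\pi n\delta/k}\;\lambda(n,k,\delta)\to 1$ as $n\delta/k\to\infty$, uniformly in $(n,k,\delta)$: for every $\varepsilon>0$ there is $M$ such that for all $n$, all $k\ge 3$ and all $\delta\in(0,1)$ with $n\delta/k\ge M$, $$\left|(1-\delta)^{-1}\sqrt{\frac{\pi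 n\delta}{k}}\;\lambda(n,k,\delta)-1\right|<\varepsilon.$$ (2) For $k=2$, $(1-\delta)^{-1}\sqrt{\pi n\delta(1-\delta/2)}\;\lambda(n,2,\delta)\to 1$ as $n\delta\to\infty$, uniformly in $(n,\delta)$: for every $\varepsilon>0$ there is $M$ such that for all $n$ and all $\delta\in(0,1)$ with $n\delta\ge M$, $$\left|(1-\delta)^{-1}\sqrt{\pi n\delta(1-\delta/2)}\;\lambda(n,2,\delta)-1\right|<\varepsilon.$$ -/

import Mathlib

/-- Payoff functions for `n` players with `k` actions each: `g a i` is the payoff of player `i`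
under the pure strategy profile `a`. -/
abbrev Payoff (n k : ℕ) : Type := (Fin n → Fin k) → Fin n → ℝ

/-- `g` is an `n`-player `k`-action game: all payoffs lie in `[0, 1]`. -/
def IsGame {n k : ℕ} (g : Payoff n k) : Prop :=
  ∀ a i, g a i ∈ Set.Icc (0 : ℝ) 1

/-- The number of players who take action `j` under the profile `a`. -/
def actionCount {n k : ℕ} (a : Fin n → Fin k) (j : Fin k) : ℕ :=
  (Finset.univ.filter (fun i => a i = j)).card

/-- `g` is anonymous: the payoff of player `i` depends only on the action of `i` and on the
number of players who take each action. -/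
def IsAnonymous {n k : ℕ} (g : Payoff n k) : Prop :=
  ∀ (i : Fin n) (a b : Fin n → Fin k), a i = b i →
    (∀ j, actionCount a j = actionCount b j) → g a i = g b i

/-- The quantities `|g_i(a) - g_i(b)|`, where `a_i = b_i` and `a`, `b` differ in exactly one
coordinate. -/
def payoffChanges {n k : ℕ} (g : Payoff n k) : Set ℝ :=
  {x | ∃ (i : Fin n) (a b : Fin n → Fin k), a i = b i ∧ hammingDist a b = 1 ∧
    x = |g a i - g b i|}

/-- The Lipschitz constant of `g`: the maximal change of a player's payoff when a single opponent
changes his action. It is a maximum by `isGreatest_lipschitzConst`. -/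
noncomputable def lipschitzConst {n k : ℕ} (g : Payoff n k) : ℝ := sSup (payoffChanges g)

/-- The probability of action `j` under the mixed strategy `(1 - δ) c + δ u`, where `u` is uniform
on the `k` actions. -/
noncomputable def perturbedProb {k : ℕ} (δ : ℝ) (c j : Fin k) : ℝ :=
  (1 - δ) * (if j = c then 1 else 0) + δ * (1 / (k : ℝ))

/-- The `δ`-perturbation of `g`: the payoff at `a` is the expectation of the payoff of `g` at a
random profile whose coordinates are independent, the `i`-th one having law
`perturbedProb δ (a i)`. -/
noncomputable def perturb {n k : ℕ} (δ : ℝ) (g : Payoff n k) : Payoff n k :=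
  fun a i => ∑ b : Fin n → Fin k, (∏ l, perturbedProb δ (a l) (b l)) * g b i

/-- The Lipschitz constants of the `δ`-perturbations of all `n`-player `k`-action anonymous
games. -/
def perturbedLipschitzConsts (n k : ℕ) (δ : ℝ) : Set ℝ :=
  {x | ∃ g : Payoff n k, IsGame g ∧ IsAnonymous g ∧ x = lipschitzConst (perturb δ g)}

/-- The worst-case Lipschitz constant of the `δ`-perturbations of `n`-player `k`-action anonymous
games. It is a maximum by `isGreatest_worstLipschitz`. -/
noncomputable def worstLipschitz (n k : ℕ) (δ : ℝ) : ℝ := sSup (perturbedLipschitzConsts n k δ)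

theorem finite_payoffChanges {n k : ℕ} (g : Payoff n k) : (payoffChanges g).Finite := by
  refine (Set.finite_range
    (fun p : Fin n × (Fin n → Fin k) × (Fin n → Fin k) => |g p.2.1 p.1 - g p.2.2 p.1|)).subset ?_
  rintro x ⟨i, a, b, -, -, rfl⟩
  exact ⟨(i, a, b), rfl⟩

theorem nonempty_payoffChanges {n k : ℕ} (hn : 2 ≤ n) (hk : 2 ≤ k) (g : Payoff n k) :
    (payoffChanges g).Nonempty := by
  let i : Fin n := ⟨0, by omega⟩
  let m : Fin n := ⟨1, by omega⟩
  let c : Fin k := ⟨0, by omega⟩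
  let d : Fin k := ⟨1, by omega⟩
  have him : i ≠ m := by simp [i, m]
  have hcd : c ≠ d := by simp [c, d]
  refine ⟨_, i, fun _ => c, Function.update (fun _ => c) m d, ?_, ?_, rfl⟩
  · simp [Function.update_of_ne him]
  · have : (Finset.univ.filter
        (fun l => (fun _ => c : Fin n → Fin k) l ≠ Function.update (fun _ => c) m d l)) = {m} := by
      ext l
      by_cases h : l = m
      · subst h; simp [hcd]
      · simp [h]
    rw [hammingDist, this, Finset.card_singleton]

theorem isGreatest_lipschitzConst {n k : ℕ} (hn : 2 ≤ n) (hk : 2 ≤ k) (g : Payoff n k) :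
    IsGreatest (payoffChanges g) (lipschitzConst g) :=
  ⟨(nonempty_payoffChanges hn hk g).csSup_mem (finite_payoffChanges g),
    fun _ hx => le_csSup (finite_payoffChanges g).bddAbove hx⟩

theorem perturbedProb_nonneg {k : ℕ} {δ : ℝ} (h0 : 0 ≤ δ) (h1 : δ ≤ 1) (c j : Fin k) :
    0 ≤ perturbedProb δ c j := by
  have : 0 ≤ 1 - δ := by linarith
  unfold perturbedProb
  split_ifs <;> positivity

theorem sum_perturbedProb {k : ℕ} (δ : ℝ) (c : Fin k) : ∑ j, perturbedProb δ c j = 1 := by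
  have hk : (k : ℝ) ≠ 0 := by
    have := c.pos
    positivity
  simp only [perturbedProb, Finset.sum_add_distrib, ← Finset.mul_sum]
  simp [hk]

theorem isGame_perturb {n k : ℕ} {δ : ℝ} (h0 : 0 ≤ δ) (h1 : δ ≤ 1) {g : Payoff n k}
    (hg : IsGame g) : IsGame (perturb δ g) := by
  intro a i
  have hp : ∀ b : Fin n → Fin k, 0 ≤ ∏ l, perturbedProb δ (a l) (b l) :=
    fun b => Finset.prod_nonneg fun l _ => perturbedProb_nonneg h0 h1 _ _
  refine ⟨Finset.sum_nonneg fun b _ => mul_nonneg (hp b) (hg b i).1, ?_⟩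
  calc perturb δ g a i ≤ ∑ b : Fin n → Fin k, ∏ l, perturbedProb δ (a l) (b l) :=
        Finset.sum_le_sum fun b _ => mul_le_of_le_one_right (hp b) (hg b i).2
    _ = ∏ l, ∑ j, perturbedProb δ (a l) j := (Fintype.prod_sum _).symm
    _ = 1 := by simp [sum_perturbedProb]

theorem isCompact_anonymousGames (n k : ℕ) :
    IsCompact {g : Payoff n k | IsGame g ∧ IsAnonymous g} := by
  have h1 : IsCompact {g : Payoff n k | IsGame g} := by
    have : {g : Payoff n k | IsGame g} =
        Set.univ.pi (fun _ => Set.univ.pi (fun _ => Set.Icc (0 : ℝ) 1)) := by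
      ext g; simp only [IsGame, Set.mem_ofPred_eq, Set.mem_pi, Set.mem_univ, true_imp_iff]
    rw [this]
    exact isCompact_univ_pi fun _ => isCompact_univ_pi fun _ => isCompact_Icc
  refine h1.inter_right (t := {g : Payoff n k | IsAnonymous g}) ?_
  simp only [IsAnonymous, Set.ofPred_forall]
  refine isClosed_iInter fun i => isClosed_iInter fun a => isClosed_iInter fun b =>
    isClosed_iInter fun _ => isClosed_iInter fun _ => isClosed_eq ?_ ?_ <;> fun_prop

theorem isGreatest_worstLipschitz {n k : ℕ} (hn : 2 ≤ n) (hk : 2 ≤ k) (δ : ℝ) :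
    IsGreatest (perturbedLipschitzConsts n k δ) (worstLipschitz n k δ) := by
  let ι := {p : Fin n × (Fin n → Fin k) × (Fin n → Fin k) //
    p.2.1 p.1 = p.2.2 p.1 ∧ hammingDist p.2.1 p.2.2 = 1}
  let F : ι → Payoff n k → ℝ := fun t g =>
    |perturb δ g t.1.2.1 t.1.1 - perturb δ g t.1.2.2 t.1.1|
  have hF : ∀ t, Continuous (F t) := fun t => by
    simp only [F, perturb]
    fun_prop
  have hne : {g : Payoff n k | IsGame g ∧ IsAnonymous g}.Nonempty :=
    ⟨fun _ _ => 0, fun _ _ => by simp, fun _ _ _ _ _ => rfl⟩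
  have hmem : ∀ g t, F t g ∈ payoffChanges (perturb δ g) := fun g t =>
    ⟨t.1.1, t.1.2.1, t.1.2.2, t.2.1, t.2.2, rfl⟩
  have hex : ∀ g, ∃ t, lipschitzConst (perturb δ g) = F t g := fun g => by
    obtain ⟨i, a, b, h, h', hx⟩ := (isGreatest_lipschitzConst hn hk (perturb δ g)).1
    exact ⟨⟨(i, a, b), h, h'⟩, hx⟩
  choose G hG hGmax using fun t =>
    (isCompact_anonymousGames n k).exists_isMaxOn hne (hF t).continuousOn
  have : Nonempty ι := (hex fun _ _ => 0).nonempty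
  obtain ⟨t, ht⟩ := Finite.exists_max fun t => F t (G t)
  have key : IsGreatest (perturbedLipschitzConsts n k δ) (lipschitzConst (perturb δ (G t))) := by
    refine ⟨⟨G t, (hG t).1, (hG t).2, rfl⟩, ?_⟩
    rintro x ⟨g, hg, hg', rfl⟩
    obtain ⟨s, hs⟩ := hex g
    rw [hs]
    exact ((hGmax s ⟨hg, hg'⟩).trans (ht s)).trans
      ((isGreatest_lipschitzConst hn hk _).2 (hmem _ t))
  rw [worstLipschitz, key.csSup_eq]
  exact key

/-! In an anonymous game a payoff depends on the player's own action and on the opponents' counts.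
If one opponent switches from `c` to `d`, the trembles of that opponent cancel, which leaves a
factor `1 - δ` times the change in the expectation of a `[0, 1]`-valued function between the laws of
`S + e_c` and `S + e_d`, where `S` is the count vector of the other `n - 2` opponents. So the worst
constant is `1 - δ` times the largest total variation distance between two such laws. With
generating polynomials this distance is governed by `(X c - X d) * ∏ linearForm`, tested by
`expect`.

For `k ≥ 3`, split from each opponent's law a tremble of mass `2δ/k`, uniform on `{c, d}`. Given `t`
such trembles, the distance is at most the largest weight of a symmetric binomial law, because
convolution with the rest cannot increase it. Averaging over `t` gives `meanMiddle`. The bound is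
attained when all `n - 2` others choose a third action, with a majority test between `c` and `d`;
hence `worstLipschitz_eq_meanMiddle`.

For `k = 2`, the count of `c` is a sum of independent Bernoulli variables. Its law is log-concave,
so the distance is bounded by its largest weight. Cauchy-Schwarz on two halves of the opponents
bounds that weight by means of central binomial weights (`sq_coeff_linearProd_le`), whatever actions
they choose; an even split of the opponents gives a matching lower bound
(`exists_meanCentral_le_coeff`).

Wallis' product makes the squared central weights about `1 / (π t)`. Jensen from above and a tangent
line from below replace random `t` by its mean, with explicit errors that depend only on that mean;
this gives the uniformity. -/

/-! ### Means under a binomial law. -/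

/-- The binomial weight of `t`, for `N` trials with success probability `r`. -/
noncomputable def binomialWeight (N : ℕ) (r : ℝ) (t : ℕ) : ℝ :=
  (N.choose t : ℝ) * r ^ t * (1 - r) ^ (N - t)

/-- The mean of `γ` under the binomial law with `N` trials and success probability `r`. -/
noncomputable def binomialMean (N : ℕ) (r : ℝ) (γ : ℕ → ℝ) : ℝ :=
  ∑ t ∈ Finset.range (N + 1), binomialWeight N r t * γ t

theorem binomialWeight_nonneg {N : ℕ} {r : ℝ} (h0 : 0 ≤ r) (h1 : r ≤ 1) (t : ℕ) :
    0 ≤ binomialWeight N r t := by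
  have : 0 ≤ 1 - r := by linarith
  unfold binomialWeight
  positivity

theorem sum_binomialWeight (N : ℕ) (r : ℝ) :
    ∑ t ∈ Finset.range (N + 1), binomialWeight N r t = 1 := by
  have h := add_pow r (1 - r) N
  rw [add_sub_cancel, one_pow] at h
  rw [h]
  exact Finset.sum_congr rfl fun t _ => by rw [binomialWeight]; ring

theorem binomialMean_mono {N : ℕ} {r : ℝ} (h0 : 0 ≤ r) (h1 : r ≤ 1) {γ γ' : ℕ → ℝ}
    (h : ∀ t, γ t ≤ γ' t) : binomialMean N r γ ≤ binomialMean N r γ' :=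
  Finset.sum_le_sum fun t _ => mul_le_mul_of_nonneg_left (h t) (binomialWeight_nonneg h0 h1 t)

theorem binomialMean_id (N : ℕ) (r : ℝ) : binomialMean N r (fun t => (t : ℝ)) = N * r := by
  cases N with
  | zero => simp [binomialMean]
  | succ M =>
    rw [binomialMean, Finset.sum_range_succ']
    have : ∀ t ∈ Finset.range (M + 1), binomialWeight (M + 1) r (t + 1) * ((t + 1 : ℕ) : ℝ) =
        ((M + 1 : ℕ) * r) * binomialWeight M r t := by
      intro t _
      have h : ((M : ℝ) + 1) * M.choose t = (M + 1).choose (t + 1) * (t + 1) := by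
        exact_mod_cast Nat.add_one_mul_choose_eq M t
      simp only [binomialWeight, Nat.add_sub_add_right]
      push_cast
      linear_combination (-(r ^ (t + 1) * (1 - r) ^ (M - t))) * h
    rw [Finset.sum_congr rfl this, ← Finset.mul_sum, sum_binomialWeight]
    simp

/-- Absorption turns `1 / (t + 1)` times a weight into a shifted weight for `N + 1` trials; only the
weight at `0` is lost. The next lemma does this twice. -/
theorem binomialMean_inv_succ_le {N : ℕ} {r : ℝ} (h0 : 0 < r) (h1 : r ≤ 1) :
    binomialMean N r (fun t => 1 / ((t : ℝ) + 1)) ≤ 1 / ((N + 1) * r) := by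
  rw [le_div_iff₀ (by positivity), binomialMean, Finset.sum_mul]
  have : ∀ t ∈ Finset.range (N + 1), binomialWeight N r t * (1 / ((t : ℝ) + 1)) * ((N + 1) * r) =
      binomialWeight (N + 1) r (t + 1) := by
    intro t _
    have h : ((N : ℝ) + 1) * N.choose t = (N + 1).choose (t + 1) * (t + 1) := by
      exact_mod_cast Nat.add_one_mul_choose_eq N t
    simp only [binomialWeight, Nat.add_sub_add_right]
    field_simp
    linear_combination (r ^ (t + 1) * (1 - r) ^ (N - t)) * h
  rw [Finset.sum_congr rfl this, ← sum_binomialWeight (N + 1) r,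
    Finset.sum_range_succ' _ (N + 1)]
  exact le_add_of_nonneg_right (binomialWeight_nonneg h0.le h1 _)

theorem binomialMean_inv_succ_mul_le {N : ℕ} {r : ℝ} (h0 : 0 < r) (h1 : r ≤ 1) :
    binomialMean N r (fun t => 1 / (((t : ℝ) + 1) * (t + 2))) ≤
      1 / ((N + 1) * (N + 2) * r ^ 2) := by
  rw [le_div_iff₀ (by positivity), binomialMean, Finset.sum_mul]
  have : ∀ t ∈ Finset.range (N + 1), binomialWeight N r t * (1 / (((t : ℝ) + 1) * (t + 2))) *
      ((N + 1) * (N + 2) * r ^ 2) = binomialWeight (N + 2) r (t + 2) := by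
    intro t _
    have h : ((N : ℝ) + 1) * N.choose t = (N + 1).choose (t + 1) * (t + 1) := by
      exact_mod_cast Nat.add_one_mul_choose_eq N t
    have h' : ((N : ℝ) + 2) * (N + 1).choose (t + 1) = (N + 2).choose (t + 2) * (t + 2) := by
      exact_mod_cast Nat.add_one_mul_choose_eq (N + 1) (t + 1)
    simp only [binomialWeight, Nat.add_sub_add_right]
    field_simp
    linear_combination (r ^ (t + 2) * (1 - r) ^ (N - t) * (N + 2)) * h +
      (r ^ (t + 2) * (1 - r) ^ (N - t) * (t + 1)) * h'
  rw [Finset.sum_congr rfl this, ← sum_binomialWeight (N + 2) r,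
    Finset.sum_range_succ' _ (N + 2), Finset.sum_range_succ' _ (N + 1)]
  have h2 := binomialWeight_nonneg (N := N + 2) h0.le h1 0
  have h3 := binomialWeight_nonneg (N := N + 2) h0.le h1 (0 + 1)
  linarith

/-- Jensen for the square. The hypothesis on `γ` uses exactly the two functions whose binomial means
have been bounded above. -/
theorem sq_binomialMean_le {N : ℕ} {r A : ℝ} {γ : ℕ → ℝ} (h0 : 0 < r) (h1 : r ≤ 1) (hA : 0 ≤ A)
    (hγ : ∀ t : ℕ, γ t ^ 2 ≤ A * (1 / ((t : ℝ) + 1) + 6 * (1 / (((t : ℝ) + 1) * (t + 2))))) :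
    binomialMean N r γ ^ 2 ≤
      A * (1 / ((N + 1) * r) + 6 * (1 / ((N + 1) * (N + 2) * r ^ 2))) := by
  calc binomialMean N r γ ^ 2 ≤ binomialMean N r (fun t => γ t ^ 2) :=
        Real.pow_arith_mean_le_arith_mean_pow_of_even _ _ _
          (fun t _ => binomialWeight_nonneg h0.le h1 t) (sum_binomialWeight N r) even_two
    _ ≤ binomialMean N r (fun t =>
          A * (1 / ((t : ℝ) + 1) + 6 * (1 / (((t : ℝ) + 1) * (t + 2))))) :=
        binomialMean_mono h0.le h1 hγ
    _ = A * (binomialMean N r (fun t => 1 / ((t : ℝ) + 1)) +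
          6 * binomialMean N r (fun t => 1 / (((t : ℝ) + 1) * (t + 2)))) := by
        simp only [binomialMean, Finset.mul_sum, ← Finset.sum_add_distrib]
        exact Finset.sum_congr rfl fun t _ => by ring
    _ ≤ _ := by
        gcongr
        · exact binomialMean_inv_succ_le h0 h1
        · exact binomialMean_inv_succ_mul_le h0 h1

/-- The function `√(A / x)` is convex, so it lies above its tangent at `N * r + 2`, the mean of `t +
2`; the mean of the tangent is its value `y` there. -/
theorem le_sq_binomialMean {N : ℕ} {r A : ℝ} {γ : ℕ → ℝ} (h0 : 0 ≤ r) (h1 : r ≤ 1) (hA : 0 ≤ A)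
    (hγ0 : ∀ t, 0 ≤ γ t) (hγ : ∀ t : ℕ, A / ((t : ℝ) + 2) ≤ γ t ^ 2) :
    A / (N * r + 2) ≤ binomialMean N r γ ^ 2 := by
  have hx0 : 0 < (N : ℝ) * r + 2 := by positivity
  set y := √(A / (N * r + 2)) with hy
  have hy2 : y ^ 2 = A / (N * r + 2) := Real.sq_sqrt (by positivity)
  have hy0 : 0 ≤ y := Real.sqrt_nonneg _
  have key : ∀ t : ℕ, y * (3 / 2 - ((t : ℝ) + 2) / (2 * (N * r + 2))) ≤ γ t := by
    intro t
    rcases hy0.eq_or_lt with h | h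
    · rw [← h, zero_mul]; exact hγ0 t
    have hA0 : 0 < A := by
      rcases hA.eq_or_lt with h' | h'
      · rw [← h', zero_div] at hy2; exact absurd hy2 (by positivity)
      · exact h'
    by_contra hlt
    push Not at hlt
    have hg := hγ0 t
    have hγp : 0 < γ t := by
      have := (div_pos hA0 (by positivity : (0 : ℝ) < (t : ℝ) + 2)).trans_le (hγ t)
      nlinarith
    have ht := hγ t
    have hAy : A = y ^ 2 * (N * r + 2) := by rw [hy2]; field_simp
    rw [div_le_iff₀ (by positivity), hAy] at ht
    have h1 : y * (3 * (N * r + 2) - (t + 2)) > 2 * (N * r + 2) * γ t := by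
      have : y * (3 / 2 - ((t : ℝ) + 2) / (2 * (N * r + 2))) * (2 * (N * r + 2)) =
          y * (3 * (N * r + 2) - (t + 2)) := by field_simp
      have h2 := mul_lt_mul_of_pos_right hlt (by positivity : 0 < 2 * ((N : ℝ) * r + 2))
      rw [this] at h2
      linarith
    have h3 : y * (3 * (N * r + 2) - (t + 2)) * γ t ^ 2 > 2 * (N * r + 2) * γ t * γ t ^ 2 :=
      mul_lt_mul_of_pos_right h1 (by positivity)
    have h4 : y * (3 * (N * r + 2)) * γ t ^ 2 - y * (y ^ 2 * (N * r + 2)) >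
        2 * (N * r + 2) * γ t ^ 3 := by nlinarith
    have h5 : 3 * y * γ t ^ 2 - y ^ 3 > 2 * γ t ^ 3 := by
      by_contra hc
      push Not at hc
      nlinarith
    -- The contradiction is `2γ³ - 3yγ² + y³ = (γ - y)² (2γ + y) ≥ 0`.
    nlinarith [mul_nonneg (sq_nonneg (γ t - y)) (by positivity : 0 ≤ 2 * γ t + y)]
  rw [← hy2]
  refine pow_le_pow_left₀ hy0 ?_ 2
  refine le_trans (le_of_eq ?_) (binomialMean_mono h0 h1 key)
  have : binomialMean N r (fun t => y * (3 / 2 - ((t : ℝ) + 2) / (2 * (N * r + 2)))) =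
      y * (3 / 2 - 2 / (2 * (N * r + 2))) * ∑ t ∈ Finset.range (N + 1), binomialWeight N r t -
        y / (2 * (N * r + 2)) * binomialMean N r (fun t => (t : ℝ)) := by
    simp only [binomialMean, Finset.mul_sum, ← Finset.sum_sub_distrib]
    exact Finset.sum_congr rfl fun t _ => by ring
  rw [this, sum_binomialWeight, binomialMean_id]
  field_simp
  ring

/-! ### Wallis bounds for central binomial weights. -/

theorem wallis_mul_centralBinom_sq (m : ℕ) :
    Real.Wallis.W m * (2 * m + 1) * ((m.centralBinom : ℝ) / 4 ^ m) ^ 2 = 1 := by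
  have h := Nat.choose_mul_factorial_mul_factorial (n := 2 * m) (k := m) (by omega)
  rw [← Nat.centralBinom_eq_two_mul_choose, show 2 * m - m = m by omega] at h
  have h' : (m.centralBinom : ℝ) * m.factorial * m.factorial = (2 * m).factorial := by
    exact_mod_cast h
  have h4 : (2 : ℝ) ^ (4 * m) = (4 ^ m) ^ 2 := by
    rw [show 4 * m = 2 * (m * 2) by ring, pow_mul, pow_mul]; norm_num
  have hf : (m.factorial : ℝ) ≠ 0 := by positivity
  have hc : (m.centralBinom : ℝ) ≠ 0 := by exact_mod_cast m.centralBinom_ne_zero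
  rw [Real.Wallis.W_eq_factorial_ratio, h4, ← h']
  field_simp

theorem le_centralBinom_sq (m : ℕ) :
    1 / (Real.pi * (m + 1 / 2)) ≤ ((m.centralBinom : ℝ) / 4 ^ m) ^ 2 := by
  have h := wallis_mul_centralBinom_sq m
  have h' := Real.Wallis.W_le m
  have hpi := Real.pi_pos
  rw [div_le_iff₀ (by positivity)]
  calc (1 : ℝ) = Real.Wallis.W m * (2 * m + 1) * ((m.centralBinom : ℝ) / 4 ^ m) ^ 2 := h.symm
    _ ≤ Real.pi / 2 * (2 * m + 1) * ((m.centralBinom : ℝ) / 4 ^ m) ^ 2 := by gcongr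
    _ = _ := by ring

theorem centralBinom_sq_le {m : ℕ} (hm : m ≠ 0) :
    ((m.centralBinom : ℝ) / 4 ^ m) ^ 2 ≤ 1 / (Real.pi * m) := by
  have h := wallis_mul_centralBinom_sq m
  have h' := Real.Wallis.le_W m
  have hpi := Real.pi_pos
  have hm' : (0 : ℝ) < m := by positivity
  rw [le_div_iff₀ (by positivity)]
  refine le_trans ?_ h.le
  have : Real.pi * m ≤ Real.Wallis.W m * (2 * m + 1) := by
    calc Real.pi * m ≤ ((2 : ℝ) * m + 1) / (2 * m + 2) * (Real.pi / 2) * (2 * m + 1) := by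
          field_simp
          nlinarith
      _ ≤ _ := by gcongr
  nlinarith [mul_le_mul_of_nonneg_left this (sq_nonneg ((m.centralBinom : ℝ) / 4 ^ m))]

theorem inv_le_inv_succ_add {t : ℝ} (ht : 1 ≤ t) :
    1 / t ≤ 1 / (t + 1) + 6 * (1 / ((t + 1) * (t + 2))) := by
  have : 1 / (t + 1) + 6 * (1 / ((t + 1) * (t + 2))) = (t + 8) / ((t + 1) * (t + 2)) := by
    field_simp
    ring
  rw [this, div_le_div_iff₀ (by positivity) (by positivity)]
  nlinarith

theorem central_sq_le (t : ℕ) : ((t.centralBinom : ℝ) / 4 ^ t) ^ 2 ≤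
    1 / Real.pi * (1 / ((t : ℝ) + 1) + 6 * (1 / (((t : ℝ) + 1) * (t + 2)))) := by
  rcases eq_or_ne t 0 with rfl | ht
  -- At `t = 0` the claim is `1 ≤ 4 / π`; the constant 6 leaves room for it.
  · have := Real.pi_lt_four
    have hpi := Real.pi_pos
    norm_num
    rw [← div_eq_inv_mul, le_div_iff₀ hpi]
    linarith
  · refine (centralBinom_sq_le ht).trans ?_
    have ht' : (1 : ℝ) ≤ t := by exact_mod_cast Nat.one_le_iff_ne_zero.2 ht
    rw [one_div_mul_eq_div, ← div_div, div_right_comm]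
    exact div_le_div_of_nonneg_right (inv_le_inv_succ_add ht') Real.pi_pos.le

theorem le_central_sq (t : ℕ) :
    1 / Real.pi / ((t : ℝ) + 2) ≤ ((t.centralBinom : ℝ) / 4 ^ t) ^ 2 := by
  refine le_trans ?_ (le_centralBinom_sq t)
  have := Real.pi_pos
  rw [div_div]
  gcongr
  norm_num

theorem middle_eq (t : ℕ) :
    (t.choose (t / 2) : ℝ) / 2 ^ t = (((t + 1) / 2).centralBinom : ℝ) / 4 ^ ((t + 1) / 2) := by
  rcases Nat.even_or_odd' t with ⟨m, rfl | rfl⟩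
  · rw [show (2 * m + 1) / 2 = m by omega, show 2 * m / 2 = m by omega,
      Nat.centralBinom_eq_two_mul_choose, pow_mul]
    norm_num
  · rw [show (2 * m + 1 + 1) / 2 = m + 1 by omega, show (2 * m + 1) / 2 = m by omega]
    have h : (m + 1).centralBinom = 2 * (2 * m + 1).choose m := by
      rw [Nat.centralBinom_eq_two_mul_choose, show 2 * (m + 1) = 2 * m + 1 + 1 by ring,
        Nat.choose_succ_succ, Nat.choose_symm_half]
      ring
    rw [h, pow_succ, pow_succ, pow_mul]
    push_cast
    norm_num
    field_simp
    ring

theorem middle_sq_le (t : ℕ) : ((t.choose (t / 2) : ℝ) / 2 ^ t) ^ 2 ≤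
    2 / Real.pi * (1 / ((t : ℝ) + 1) + 6 * (1 / (((t : ℝ) + 1) * (t + 2)))) := by
  have hpi := Real.pi_pos
  rcases eq_or_ne t 0 with rfl | ht
  · have := Real.pi_lt_four
    norm_num
    rw [div_mul_eq_mul_div, le_div_iff₀ hpi]
    linarith
  · have ht' : (1 : ℝ) ≤ t := by exact_mod_cast Nat.one_le_iff_ne_zero.2 ht
    have hm : (t : ℝ) ≤ 2 * ((t + 1) / 2 : ℕ) := by
      exact_mod_cast (by omega : t ≤ 2 * ((t + 1) / 2))
    rw [middle_eq]
    refine (centralBinom_sq_le (by omega)).trans ?_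
    refine le_trans ?_
      (mul_le_mul_of_nonneg_left (inv_le_inv_succ_add ht') (by positivity : 0 ≤ 2 / Real.pi))
    rw [div_mul_div_comm, div_le_div_iff₀ (by nlinarith) (by positivity)]
    nlinarith

theorem le_middle_sq (t : ℕ) :
    2 / Real.pi / ((t : ℝ) + 2) ≤ ((t.choose (t / 2) : ℝ) / 2 ^ t) ^ 2 := by
  have hpi := Real.pi_pos
  have hm : 2 * (((t + 1) / 2 : ℕ) : ℝ) ≤ t + 1 := by
    exact_mod_cast (by omega : 2 * ((t + 1) / 2) ≤ t + 1)
  rw [middle_eq]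
  refine le_trans ?_ (le_centralBinom_sq _)
  rw [div_div, div_le_div_iff₀ (by positivity) (by positivity)]
  nlinarith

/-! ### The two means that describe the worst case. -/

/-- The mean of the largest probability of a symmetric binomial law whose number of trials is
itself binomial. -/
noncomputable def meanMiddle (N : ℕ) (r : ℝ) : ℝ :=
  binomialMean N r (fun t => (t.choose (t / 2) : ℝ) / 2 ^ t)

/-- The mean of `C(2 t, t) / 4 ^ t` for binomial `t`. -/
noncomputable def meanCentral (N : ℕ) (r : ℝ) : ℝ :=
  binomialMean N r (fun t => (t.centralBinom : ℝ) / 4 ^ t)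

theorem binomialMean_nonneg {N : ℕ} {r : ℝ} {γ : ℕ → ℝ} (h0 : 0 ≤ r) (h1 : r ≤ 1)
    (h : ∀ t, 0 ≤ γ t) : 0 ≤ binomialMean N r γ :=
  Finset.sum_nonneg fun t _ => mul_nonneg (binomialWeight_nonneg h0 h1 t) (h t)

theorem meanMiddle_nonneg {N : ℕ} {r : ℝ} (h0 : 0 ≤ r) (h1 : r ≤ 1) : 0 ≤ meanMiddle N r :=
  binomialMean_nonneg h0 h1 fun _ => by positivity

theorem meanCentral_nonneg {N : ℕ} {r : ℝ} (h0 : 0 ≤ r) (h1 : r ≤ 1) : 0 ≤ meanCentral N r :=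
  binomialMean_nonneg h0 h1 fun _ => by positivity

theorem sq_meanMiddle_le {N : ℕ} {r : ℝ} (h0 : 0 < r) (h1 : r ≤ 1) : meanMiddle N r ^ 2 ≤
    2 / Real.pi * (1 / ((N + 1) * r) + 6 * (1 / ((N + 1) * (N + 2) * r ^ 2))) :=
  sq_binomialMean_le h0 h1 (by positivity) middle_sq_le

theorem le_sq_meanMiddle {N : ℕ} {r : ℝ} (h0 : 0 ≤ r) (h1 : r ≤ 1) :
    2 / Real.pi / (N * r + 2) ≤ meanMiddle N r ^ 2 :=
  le_sq_binomialMean h0 h1 (by positivity) (fun _ => by positivity) le_middle_sq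

theorem sq_meanCentral_le {N : ℕ} {r : ℝ} (h0 : 0 < r) (h1 : r ≤ 1) : meanCentral N r ^ 2 ≤
    1 / Real.pi * (1 / ((N + 1) * r) + 6 * (1 / ((N + 1) * (N + 2) * r ^ 2))) :=
  sq_binomialMean_le h0 h1 (by positivity) central_sq_le

theorem le_sq_meanCentral {N : ℕ} {r : ℝ} (h0 : 0 ≤ r) (h1 : r ≤ 1) :
    1 / Real.pi / (N * r + 2) ≤ meanCentral N r ^ 2 :=
  le_sq_binomialMean h0 h1 (by positivity) (fun _ => by positivity) le_central_sq

/-! ### Log-concave weights and increments of bounded functions. -/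

/-- A nonnegative sequence that is log-concave without internal zeros. -/
def IsLogConcave (f : ℕ → ℝ) : Prop :=
  (∀ i, 0 ≤ f i) ∧ ∀ i j, i ≤ j → f i * f (j + 2) ≤ f (i + 1) * f (j + 1)

/-- A log-concave sequence is unimodal, so the expected increment of a function with values in
`[0, 1]` is at most the largest weight. -/
theorem IsLogConcave.sum_mul_sub_le {f : ℕ → ℝ} (hf : IsLogConcave f) {K : ℝ} {N : ℕ}
    (hK : ∀ j, f j ≤ K) {u : ℕ → ℝ} (hu : ∀ j, u j ∈ Set.Icc (0 : ℝ) 1) :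
    ∑ i ∈ Finset.range (N + 1), f i * (u (i + 1) - u i) ≤ K := by
  obtain ⟨m, hm, hmax⟩ := Finset.exists_max_image (Finset.range (N + 1)) f ⟨0, by simp⟩
  simp only [Finset.mem_range] at hm hmax
  rcases (hf.1 m).eq_or_lt with h0 | h0
  · refine (Finset.sum_nonpos fun i hi => ?_).trans ((hf.1 0).trans (hK 0))
    have := le_antisymm (h0 ▸ hmax i (Finset.mem_range.1 hi)) (hf.1 i)
    simp [this]
  -- Log-concavity across the gap from `i` to the mode `m`, then cancellation of `f m > 0`.
  have hup : ∀ i, i < m → f i ≤ f (i + 1) := by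
    intro i hi
    rcases (Nat.succ_le_of_lt hi).eq_or_lt with h | h
    · rw [← Nat.succ_eq_add_one, h]; exact hmax i (by omega)
    · obtain ⟨j, rfl⟩ : ∃ j, m = j + 2 := ⟨m - 2, by omega⟩
      have h1 := hf.2 i j (by omega)
      have h2 := mul_le_mul_of_nonneg_left (hmax (j + 1) (by omega)) (hf.1 (i + 1))
      exact le_of_mul_le_mul_right (h1.trans h2) h0
  have hdown : ∀ J, m ≤ J → J < N → f (J + 1) ≤ f J := by
    intro J hJ hJN
    rcases hJ.eq_or_lt with h | h
    · subst h; exact hmax _ (by omega)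
    · obtain ⟨j, rfl⟩ : ∃ j, J = j + 1 := ⟨J - 1, by omega⟩
      have h1 := hf.2 m j (by omega)
      have h2 := mul_le_mul_of_nonneg_right (hmax (m + 1) (by omega)) (hf.1 (j + 1))
      exact le_of_mul_le_mul_left (h1.trans h2) h0
  -- Summation by parts: `f` increases up to the mode, where `u ≥ 0` is used, and decreases after
  -- it, where `u ≤ 1` is used.
  have h1 : ∀ j, j ≤ m → ∑ i ∈ Finset.range (j + 1), f i * (u (i + 1) - u i) ≤
      f j * u (j + 1) := by
    intro j
    induction j with
    | zero =>
      intro _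
      rw [zero_add, Finset.sum_range_one]
      have := mul_nonneg (hf.1 0) (hu 0).1
      linarith
    | succ j ih =>
      intro hj
      rw [Finset.sum_range_succ]
      have := mul_le_mul_of_nonneg_right (hup j (by omega)) (hu (j + 1)).1
      linarith [ih (by omega)]
  have h2 : ∀ j, m ≤ j → j ≤ N → ∑ i ∈ Finset.range (j + 1), f i * (u (i + 1) - u i) ≤
      f m - f j * (1 - u (j + 1)) := by
    intro j hj
    induction j, hj using Nat.le_induction with
    | base => intro _; linarith [h1 m le_rfl]
    | succ j hj ih =>
      intro hjN
      rw [Finset.sum_range_succ]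
      have := mul_le_mul_of_nonneg_right (hdown j hj (by omega)) (sub_nonneg.2 (hu (j + 1)).2)
      linarith [ih (by omega)]
  have h3 := mul_nonneg (hf.1 N) (sub_nonneg.2 (hu (N + 1)).2)
  linarith [h2 N (by omega) le_rfl, hK m]

theorem IsLogConcave.abs_sum_mul_sub_le {f : ℕ → ℝ} (hf : IsLogConcave f) {K : ℝ} {N : ℕ}
    (hK : ∀ j, f j ≤ K) {u : ℕ → ℝ} (hu : ∀ j, u j ∈ Set.Icc (0 : ℝ) 1) :
    |∑ i ∈ Finset.range (N + 1), f i * (u (i + 1) - u i)| ≤ K := by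
  refine abs_le'.2 ⟨hf.sum_mul_sub_le hK hu, ?_⟩
  refine le_trans (le_of_eq ?_) (hf.sum_mul_sub_le (N := N) hK (u := fun j => 1 - u j)
    fun j => ⟨sub_nonneg.2 (hu j).2, sub_le_self _ (hu j).1⟩)
  rw [← Finset.sum_neg_distrib]
  exact Finset.sum_congr rfl fun i _ => by ring

/-! ### Coefficients of products of linear polynomials. -/

open Polynomial in
/-- The product of the linear polynomials `p l * X + q l`. -/
noncomputable def linearProd {ι : Type*} (s : Finset ι) (p q : ι → ℝ) : ℝ[X] :=
  ∏ l ∈ s, (C (p l) * X + C (q l))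

section
open Polynomial

theorem coeff_zero_linear_mul (p q : ℝ) (F : ℝ[X]) :
    ((C p * X + C q) * F).coeff 0 = q * F.coeff 0 := by
  simp [mul_coeff_zero]

theorem coeff_succ_linear_mul (p q : ℝ) (F : ℝ[X]) (j : ℕ) :
    ((C p * X + C q) * F).coeff (j + 1) = p * F.coeff j + q * F.coeff (j + 1) := by
  rw [add_mul, coeff_add, mul_assoc, coeff_C_mul, coeff_C_mul, coeff_X_mul]

theorem isLogConcave_linear_mul {p q : ℝ} (hp : 0 ≤ p) (hq : 0 ≤ q) {F : ℝ[X]}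
    (hF : IsLogConcave F.coeff) : IsLogConcave ((C p * X + C q) * F).coeff := by
  obtain ⟨h0, hF⟩ := hF
  refine ⟨fun i => ?_, fun i j hij => ?_⟩
  · cases i with
    | zero => rw [coeff_zero_linear_mul]; exact mul_nonneg hq (h0 0)
    | succ i =>
      rw [coeff_succ_linear_mul]
      exact add_nonneg (mul_nonneg hp (h0 _)) (mul_nonneg hq (h0 _))
  have hqq := mul_nonneg hq hq
  have hpp := mul_nonneg hp hp
  have hpq := mul_nonneg hp hq
  cases i with
  | zero =>
    rw [coeff_zero_linear_mul, coeff_succ_linear_mul, coeff_succ_linear_mul,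
      coeff_succ_linear_mul]
    have h1 := mul_le_mul_of_nonneg_left (hF 0 j hij) hqq
    have h2 := mul_nonneg hpp (mul_nonneg (h0 0) (h0 j))
    have h3 := mul_nonneg hpq (mul_nonneg (h0 (0 + 1)) (h0 j))
    linarith
  | succ i =>
    obtain ⟨j, rfl⟩ : ∃ j', j = j' + 1 := ⟨j - 1, by omega⟩
    simp only [coeff_succ_linear_mul]
    have h1 := mul_le_mul_of_nonneg_left (hF (i + 1) (j + 1) hij) hqq
    have h2 := mul_le_mul_of_nonneg_left (hF i j (by omega)) hpp
    -- In the `p * q` terms one product occurs on both sides; this is what remains. It takes two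
    -- applications of log-concavity, or one if `i = j`.
    have h3 : F.coeff i * F.coeff (j + 3) ≤ F.coeff (i + 2) * F.coeff (j + 1) := by
      rcases hij.eq_or_lt with h | h
      · have h4 := hF i (j + 1) (by omega)
        have : i = j := by omega
        subst this
        linarith
      · exact (hF i (j + 1) (by omega)).trans (hF (i + 1) j (by omega))
    have h4 := mul_le_mul_of_nonneg_left h3 hpq
    linarith

theorem isLogConcave_linearProd {ι : Type*} {s : Finset ι} {p q : ι → ℝ}
    (hp : ∀ l ∈ s, 0 ≤ p l) (hq : ∀ l ∈ s, 0 ≤ q l) : IsLogConcave (linearProd s p q).coeff := by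
  classical
  induction s using Finset.induction_on with
  | empty =>
    refine ⟨fun i => ?_, fun i j _ => ?_⟩
    · simp only [linearProd, Finset.prod_empty, coeff_one]
      split_ifs <;> norm_num
    · simp [linearProd, coeff_one]
  | insert l s hl ih =>
    rw [linearProd, Finset.prod_insert hl]
    exact isLogConcave_linear_mul (hp l (by simp)) (hq l (by simp))
      (ih (fun l h => hp l (by simp [h])) fun l h => hq l (by simp [h]))

theorem linearProd_insert {ι : Type*} [DecidableEq ι] {s : Finset ι} {l : ι} (hl : l ∉ s)
    (p q : ι → ℝ) :
    linearProd (insert l s) p q = (C (p l) * X + C (q l)) * linearProd s p q :=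
  Finset.prod_insert hl

theorem coeff_linearProd_eq_zero {ι : Type*} (s : Finset ι) (p q : ι → ℝ) {j : ℕ}
    (hj : s.card < j) : (linearProd s p q).coeff j = 0 := by
  classical
  induction s using Finset.induction_on generalizing j with
  | empty => simp only [linearProd, Finset.prod_empty, coeff_one]; simp at hj; simp; omega
  | insert l s hl ih =>
    rw [linearProd_insert hl]
    rw [Finset.card_insert_of_notMem hl] at hj
    obtain ⟨j, rfl⟩ : ∃ j', j = j' + 1 := ⟨j - 1, by omega⟩
    rw [coeff_succ_linear_mul, ih (by omega), ih (by omega)]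
    simp

/-- Exchanging `p` and `q` reverses the polynomial, so a sum of squared coefficients becomes one
coefficient of a product. -/
theorem coeff_linearProd_swap {ι : Type*} (s : Finset ι) (p q : ι → ℝ) {i j : ℕ}
    (h : i + j = s.card) : (linearProd s q p).coeff j = (linearProd s p q).coeff i := by
  classical
  induction s using Finset.induction_on generalizing i j with
  | empty => simp at h; simp [linearProd, h]
  | insert l s hl ih =>
    rw [Finset.card_insert_of_notMem hl] at h
    rw [linearProd_insert hl, linearProd_insert hl]
    rcases i with _ | i
    · obtain ⟨j, rfl⟩ : ∃ j', j = j' + 1 := ⟨j - 1, by omega⟩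
      rw [coeff_succ_linear_mul, coeff_zero_linear_mul, ih (i := 0) (j := j) (by omega),
        coeff_linearProd_eq_zero s _ _ (j := j + 1) (by omega)]
      ring
    · rcases j with _ | j
      · rw [coeff_succ_linear_mul, coeff_zero_linear_mul, ih (i := i) (by omega),
          coeff_linearProd_eq_zero s _ _ (j := i + 1) (by omega)]
        ring
      · rw [coeff_succ_linear_mul, coeff_succ_linear_mul, ih (i := i + 1) (by omega),
          ih (i := i) (by omega)]
        ring

/-- Since `(pX + q)(qX + p) = pq (X + 1)² + (1 - 4pq) X`, this is a lazy walk: each step is a double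
fair step with probability `4pq` and otherwise stays put. Expand over the number of moves. -/
theorem coeff_lazy_pow (p q : ℝ) (m : ℕ) (hpq : p + q = 1) :
    (((C p * X + C q) * (C q * X + C p)) ^ m).coeff m = meanCentral m (4 * p * q) := by
  have h : (C p * X + C q) * (C q * X + C p) =
      C (p * q) * (X + 1) ^ 2 + C (1 - 4 * p * q) * (X : ℝ[X]) := by
    have : 1 - 4 * p * q = p ^ 2 + q ^ 2 - 2 * (p * q) := by
      rw [← one_pow 2, ← hpq]; ring
    rw [this]
    simp only [map_add, map_sub, map_mul, map_pow, map_ofNat]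
    ring
  rw [h, add_pow, finsetSum_coeff, meanCentral, binomialMean]
  refine Finset.sum_congr rfl fun t ht => ?_
  have ht : t ≤ m := Nat.lt_succ_iff.1 (Finset.mem_range.1 ht)
  have : (C (p * q) * (X + 1) ^ 2) ^ t * (C (1 - 4 * p * q) * (X : ℝ[X])) ^ (m - t) *
      (m.choose t : ℝ[X]) =
      C ((p * q) ^ t * (1 - 4 * p * q) ^ (m - t) * m.choose t) *
        ((X + 1) ^ (2 * t) * X ^ (m - t)) := by
    simp only [map_mul, map_pow, map_natCast, mul_pow, ← pow_mul]
    ring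
  rw [this, coeff_C_mul]
  obtain ⟨d, rfl⟩ := Nat.exists_eq_add_of_le ht
  rw [Nat.add_sub_cancel_left, coeff_mul_X_pow, coeff_X_add_one_pow,
    ← Nat.centralBinom_eq_two_mul_choose, binomialWeight, Nat.add_sub_cancel_left]
  have : (4 : ℝ) ^ t ≠ 0 := by positivity
  field_simp
  ring

/-- The sum of the squared coefficients of a product of `m` linear polynomials, each of which is
`p X + q` or `q X + p`. -/
theorem sum_sq_coeff_linearProd {ι : Type*} (s : Finset ι) {P Q : ι → ℝ} {p q : ℝ}
    (hpq : p + q = 1) (h : ∀ l ∈ s, P l = p ∧ Q l = q ∨ P l = q ∧ Q l = p) :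
    ∑ i ∈ Finset.range (s.card + 1), (linearProd s P Q).coeff i ^ 2 =
      meanCentral s.card (4 * p * q) := by
  rw [← coeff_lazy_pow p q _ hpq]
  have : ((C p * X + C q) * (C q * X + C p)) ^ s.card = linearProd s P Q * linearProd s Q P := by
    rw [linearProd, linearProd, ← Finset.prod_mul_distrib, ← Finset.prod_const]
    refine Finset.prod_congr rfl fun l hl => ?_
    rcases h l hl with ⟨h1, h2⟩ | ⟨h1, h2⟩
    · rw [h1, h2]
    · rw [h1, h2, mul_comm]
  rw [this, coeff_mul, Finset.Nat.sum_antidiagonal_eq_sum_range_succ_mk]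
  refine Finset.sum_congr rfl fun i hi => ?_
  rw [coeff_linearProd_swap s P Q (i := i) (by have := Finset.mem_range.1 hi; omega), sq]

theorem sum_sq_coeff_range_le {ι : Type*} (s : Finset ι) {P Q : ι → ℝ} {p q : ℝ}
    (hpq : p + q = 1) (h : ∀ l ∈ s, P l = p ∧ Q l = q ∨ P l = q ∧ Q l = p) (M : ℕ) :
    ∑ i ∈ Finset.range (M + 1), (linearProd s P Q).coeff i ^ 2 ≤
      meanCentral s.card (4 * p * q) := by
  rw [← sum_sq_coeff_linearProd s hpq h]
  have hsub : Finset.range (s.card + 1) ⊆ Finset.range (max M s.card + 1) := by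
    simp
  rw [Finset.sum_subset hsub fun i _ hi => by
    rw [coeff_linearProd_eq_zero s P Q (by simpa using hi), zero_pow two_ne_zero]]
  exact Finset.sum_le_sum_of_subset_of_nonneg (by simp) fun _ _ _ => sq_nonneg _

/-- Split the factors into two halves and apply Cauchy-Schwarz to the convolution. The sums of
squares do not see which factors are `pX + q` and which are `qX + p`. -/
theorem sq_coeff_linearProd_le {ι : Type*} (s : Finset ι) {P Q : ι → ℝ} {p q : ℝ}
    (hpq : p + q = 1) (h : ∀ l ∈ s, P l = p ∧ Q l = q ∨ P l = q ∧ Q l = p) (j : ℕ) :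
    (linearProd s P Q).coeff j ^ 2 ≤ meanCentral (s.card / 2) (4 * p * q) *
      meanCentral (s.card - s.card / 2) (4 * p * q) := by
  classical
  obtain ⟨s', hs', hc⟩ := Finset.exists_subset_card_eq (Nat.div_le_self s.card 2)
  have hmul : linearProd s P Q = linearProd s' P Q * linearProd (s \ s') P Q := by
    rw [mul_comm]; exact (Finset.prod_sdiff hs').symm
  have hc' : (s \ s').card = s.card - s.card / 2 := by rw [Finset.card_sdiff_of_subset hs', hc]
  rw [hmul, coeff_mul, ← hc', ← hc]
  refine (Finset.sum_mul_sq_le_sq_mul_sq _ _ _).trans ?_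
  have h1 := sum_sq_coeff_range_le s' hpq (fun l hl => h l (hs' hl)) j
  have h2 := sum_sq_coeff_range_le (s \ s') hpq (fun l hl => h l (Finset.mem_sdiff.1 hl).1) j
  refine mul_le_mul ?_ ?_ (Finset.sum_nonneg fun _ _ => sq_nonneg _) ?_
  · rwa [Finset.Nat.sum_antidiagonal_eq_sum_range_succ_mk]
  · rw [← Finset.Nat.sum_antidiagonal_swap, Finset.Nat.sum_antidiagonal_eq_sum_range_succ_mk]
    exact h2
  · exact le_trans (Finset.sum_nonneg fun _ _ => sq_nonneg _) h1

/-- For half of the factors `p X + q` and the other half `q X + p`, some coefficient of the product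
is at least `meanCentral`. -/
theorem exists_meanCentral_le_coeff {p q : ℝ} (hp : 0 ≤ p) (hq : 0 ≤ q) (hpq : p + q = 1) (N : ℕ) :
    ∃ j, meanCentral (N - N / 2) (4 * p * q) ≤
      ((C p * X + C q) ^ (N - N / 2) * (C q * X + C p) ^ (N / 2)).coeff j := by
  rcases Nat.even_or_odd' N with ⟨m, rfl | rfl⟩
  · refine ⟨m, le_of_eq ?_⟩
    rw [show 2 * m / 2 = m by omega, show 2 * m - m = m by omega, ← mul_pow,
      coeff_lazy_pow p q m hpq]
  · rw [show (2 * m + 1) / 2 = m by omega, show 2 * m + 1 - m = m + 1 by omega]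
    set H : ℝ[X] := (C p * X + C q) ^ (m + 1) * (C q * X + C p) ^ m with hH
    have h : ((C p * X + C q) * (C q * X + C p)) ^ (m + 1) = (C q * X + C p) * H := by
      rw [hH, mul_pow, pow_succ (C q * X + C p)]; ring
    rw [← coeff_lazy_pow p q (m + 1) hpq, h, coeff_succ_linear_mul]
    -- The coefficient of the even product is a convex combination of two adjacent coefficients of
    -- `H`, so the larger one suffices.
    rcases le_total (H.coeff m) (H.coeff (m + 1)) with hle | hle
    · refine ⟨m + 1, ?_⟩
      calc _ ≤ q * H.coeff (m + 1) + p * H.coeff (m + 1) := by gcongr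
        _ = _ := by rw [← add_mul, add_comm, hpq, one_mul]
    · refine ⟨m, ?_⟩
      calc _ ≤ q * H.coeff m + p * H.coeff m := by gcongr
        _ = _ := by rw [← add_mul, add_comm, hpq, one_mul]

end

/-! ### Generating polynomials of count vectors and bounded tests. -/

section
open MvPolynomial

variable {σ : Type*}

/-- The linear functional on polynomials that sends the monomial with exponent `m` to `h m`. For the
generating polynomial of a random count vector it is the expectation of `h`. -/
noncomputable def expect (h : (σ →₀ ℕ) → ℝ) : MvPolynomial σ ℝ →ₗ[ℝ] ℝ :=
  (basisMonomials σ ℝ).constr ℝ h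

theorem expect_monomial (h : (σ →₀ ℕ) → ℝ) (m : σ →₀ ℕ) (a : ℝ) :
    expect h (monomial m a) = a * h m := by
  have : monomial m a = a • (basisMonomials σ ℝ m) := by
    rw [coe_basisMonomials, smul_monomial, smul_eq_mul, mul_one]
  rw [this, map_smul, expect, Module.Basis.constr_basis, smul_eq_mul]

theorem expect_C_mul (h : (σ →₀ ℕ) → ℝ) (a : ℝ) (p : MvPolynomial σ ℝ) :
    expect h (C a * p) = a * expect h p := by
  rw [C_mul', map_smul, smul_eq_mul]

theorem expect_X_mul (h : (σ →₀ ℕ) → ℝ) (j : σ) (p : MvPolynomial σ ℝ) :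
    expect h (X j * p) = expect (fun m => h (Finsupp.single j 1 + m)) p := by
  induction p using MvPolynomial.induction_on' with
  | monomial m a => rw [X, monomial_mul, one_mul, expect_monomial, expect_monomial]
  | add p q hp hq => rw [mul_add, map_add, map_add, hp, hq]

/-- All functions with values in `[0, 1]` have expectation at most `K` in absolute value. -/
def IsTestBounded (p : MvPolynomial σ ℝ) (K : ℝ) : Prop :=
  ∀ h : (σ →₀ ℕ) → ℝ, (∀ m, h m ∈ Set.Icc (0 : ℝ) 1) → |expect h p| ≤ K

theorem IsTestBounded.mono {p : MvPolynomial σ ℝ} {K K' : ℝ} (hp : IsTestBounded p K)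
    (h : K ≤ K') : IsTestBounded p K' := fun f hf => (hp f hf).trans h

theorem IsTestBounded.C_mul {p : MvPolynomial σ ℝ} {K a : ℝ} (hp : IsTestBounded p K)
    (ha : 0 ≤ a) : IsTestBounded (C a * p) (a * K) := fun h hh => by
  rw [expect_C_mul, abs_mul, abs_of_nonneg ha]
  exact mul_le_mul_of_nonneg_left (hp h hh) ha

theorem IsTestBounded.X_mul {p : MvPolynomial σ ℝ} {K : ℝ} (hp : IsTestBounded p K) (j : σ) :
    IsTestBounded (X j * p) K := fun h hh => by
  rw [expect_X_mul]
  exact hp _ fun m => hh _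

theorem IsTestBounded.sum {ι : Type*} {s : Finset ι} {p : ι → MvPolynomial σ ℝ} {K : ι → ℝ}
    (hp : ∀ i ∈ s, IsTestBounded (p i) (K i)) : IsTestBounded (∑ i ∈ s, p i) (∑ i ∈ s, K i) :=
  fun h hh => by
    rw [map_sum]
    exact (Finset.abs_sum_le_sum_abs _ _).trans (Finset.sum_le_sum fun i hi => hp i hi h hh)

/-- The linear form with coefficients `w`. -/
noncomputable def linearForm [Fintype σ] (w : σ → ℝ) : MvPolynomial σ ℝ := ∑ j, C (w j) * X j

theorem linearForm_mul [Fintype σ] (w : σ → ℝ) (p : MvPolynomial σ ℝ) :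
    linearForm w * p = ∑ j, C (w j) * (X j * p) := by
  rw [linearForm, Finset.sum_mul]
  exact Finset.sum_congr rfl fun j _ => mul_assoc _ _ _

/-- Multiplication by `X j` only shifts the test, so adding an independent player scales the bound
by that player's total mass. -/
theorem IsTestBounded.linearForm_mul [Fintype σ] {p : MvPolynomial σ ℝ} {K : ℝ}
    (hp : IsTestBounded p K)
    {w : σ → ℝ} (hw : ∀ j, 0 ≤ w j) : IsTestBounded (linearForm w * p) ((∑ j, w j) * K) := by
  rw [_root_.linearForm_mul, Finset.sum_mul]
  exact IsTestBounded.sum fun j _ => (hp.X_mul j).C_mul (hw j)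

theorem IsTestBounded.prod_linearForm_mul [Fintype σ] {p : MvPolynomial σ ℝ} {K : ℝ}
    (hp : IsTestBounded p K)
    {ι : Type*} (s : Finset ι) {w : ι → σ → ℝ} (hw : ∀ l ∈ s, ∀ j, 0 ≤ w l j) :
    IsTestBounded ((∏ l ∈ s, linearForm (w l)) * p) ((∏ l ∈ s, ∑ j, w l j) * K) := by
  classical
  induction s using Finset.induction_on with
  | empty => simpa using hp
  | insert l s hl ih =>
    rw [Finset.prod_insert hl, Finset.prod_insert hl, mul_assoc, mul_assoc]
    exact (ih fun l h => hw l (by simp [h])).linearForm_mul (hw l (by simp))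

theorem prod_pair_eq {ι : Type*} (s : Finset ι) (p q : ι → ℝ) (c d : σ) :
    ∏ l ∈ s, (C (p l) * X c + C (q l) * X d : MvPolynomial σ ℝ) =
      ∑ x ∈ Finset.HasAntidiagonal.antidiagonal s.card,
        C ((linearProd s p q).coeff x.1) * (X c ^ x.1 * X d ^ x.2) := by
  classical
  induction s using Finset.induction_on with
  | empty => simp [linearProd]
  | insert l s hl ih =>
    rw [Finset.prod_insert hl, Finset.card_insert_of_notMem hl, ih, linearProd_insert hl,
      Finset.Nat.sum_antidiagonal_succ, coeff_zero_linear_mul]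
    simp only [coeff_succ_linear_mul]
    have h1 : ∑ x ∈ Finset.HasAntidiagonal.antidiagonal (s.card + 1),
          C (q l) * (C ((linearProd s p q).coeff x.1) * (X c ^ x.1 * X d ^ x.2)) =
        C (q l * (linearProd s p q).coeff 0) * (X c ^ 0 * X d ^ (s.card + 1)) +
          ∑ x ∈ Finset.HasAntidiagonal.antidiagonal s.card,
            C (q l * (linearProd s p q).coeff (x.1 + 1)) *
              (X c ^ (x.1 + 1) * X d ^ x.2 : MvPolynomial σ ℝ) := by
      rw [Finset.Nat.sum_antidiagonal_succ, C_mul, mul_assoc]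
      congr 1
      exact Finset.sum_congr rfl fun x _ => by rw [C_mul, mul_assoc]
    have h2 : ∑ x ∈ Finset.HasAntidiagonal.antidiagonal (s.card + 1),
          C (q l) * (C ((linearProd s p q).coeff x.1) * (X c ^ x.1 * X d ^ x.2)) =
          ∑ x ∈ Finset.HasAntidiagonal.antidiagonal s.card,
            C (q l) * (C ((linearProd s p q).coeff x.1)) *
              (X c ^ x.1 * X d ^ (x.2 + 1) : MvPolynomial σ ℝ) := by
      rw [Finset.Nat.sum_antidiagonal_succ', coeff_linearProd_eq_zero s p q (Nat.lt_succ_self _)]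
      simp [mul_assoc]
    rw [h1] at h2
    have h3 : ∀ x : ℕ × ℕ, C (p l * (linearProd s p q).coeff x.1 +
        q l * (linearProd s p q).coeff (x.1 + 1)) * (X c ^ (x.1 + 1) * X d ^ x.2) =
        C (p l * (linearProd s p q).coeff x.1) * (X c ^ (x.1 + 1) * X d ^ x.2) +
        C (q l * (linearProd s p q).coeff (x.1 + 1)) *
          (X c ^ (x.1 + 1) * X d ^ x.2 : MvPolynomial σ ℝ) := fun x => by rw [C_add, add_mul]
    simp only [h3, Finset.sum_add_distrib]
    rw [add_left_comm, h2, ← Finset.sum_add_distrib, Finset.mul_sum]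
    refine Finset.sum_congr rfl fun x _ => ?_
    rw [C_mul]
    ring

/-- With two actions the counts move on a line, and `X c - X d` turns the expectation into a
weighted sum of increments of `h` along it. -/
theorem expect_sub_mul_prod_pair {ι : Type*} (s : Finset ι) (p q : ι → ℝ) (c d : σ)
    (h : (σ →₀ ℕ) → ℝ) :
    expect h ((X c - X d) * ∏ l ∈ s, (C (p l) * X c + C (q l) * X d)) =
      ∑ i ∈ Finset.range (s.card + 1), (linearProd s p q).coeff i *
        (h (Finsupp.single c (i + 1) + Finsupp.single d (s.card + 1 - (i + 1))) -
          h (Finsupp.single c i + Finsupp.single d (s.card + 1 - i))) := by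
  rw [prod_pair_eq, Finset.mul_sum, map_sum, Finset.Nat.sum_antidiagonal_eq_sum_range_succ_mk]
  refine Finset.sum_congr rfl fun i hi => ?_
  have hi : i ≤ s.card := Nat.lt_succ_iff.1 (Finset.mem_range.1 hi)
  have : (X c - X d) * (C ((linearProd s p q).coeff i) * (X c ^ i * X d ^ (s.card - i))) =
      C ((linearProd s p q).coeff i) * (X c ^ (i + 1) * X d ^ (s.card + 1 - (i + 1)) -
        X c ^ i * X d ^ (s.card + 1 - i) : MvPolynomial σ ℝ) := by
    rw [Nat.add_sub_add_right, Nat.succ_sub hi, Nat.succ_eq_add_one]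
    ring
  have hm : ∀ a b : ℕ, (X c ^ a * X d ^ b : MvPolynomial σ ℝ) =
      monomial (Finsupp.single c a + Finsupp.single d b) 1 := fun a b => by
    rw [X_pow_eq_monomial, X_pow_eq_monomial, monomial_mul, one_mul]
  rw [this, expect_C_mul, map_sub, hm, hm, expect_monomial, expect_monomial, one_mul, one_mul]

theorem isTestBounded_sub_mul_prod_pair {ι : Type*} {s : Finset ι} {p q : ι → ℝ} (c d : σ)
    (hp : ∀ l ∈ s, 0 ≤ p l) (hq : ∀ l ∈ s, 0 ≤ q l) {K : ℝ}
    (hK : ∀ j, (linearProd s p q).coeff j ≤ K) :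
    IsTestBounded ((X c - X d) * ∏ l ∈ s, (C (p l) * X c + C (q l) * X d)) K := fun h hh => by
  rw [expect_sub_mul_prod_pair]
  exact (isLogConcave_linearProd hp hq).abs_sum_mul_sub_le hK
    (u := fun i => h (Finsupp.single c i + Finsupp.single d (s.card + 1 - i))) fun _ => hh _

theorem linearProd_range_one (t : ℕ) :
    linearProd (Finset.range t) (fun _ => 1) (fun _ => 1) =
      (Polynomial.X + 1 : Polynomial ℝ) ^ t := by
  simp [linearProd]

theorem prod_pair_range_one (c d : σ) (t : ℕ) :
    ∏ _l ∈ Finset.range t, (C 1 * X c + C 1 * X d : MvPolynomial σ ℝ) = (X c + X d) ^ t := by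
  simp

theorem isTestBounded_sub_mul_add_pow (c d : σ) (t : ℕ) :
    IsTestBounded ((X c - X d) * (X c + X d) ^ t : MvPolynomial σ ℝ) (t.choose (t / 2)) := by
  rw [← prod_pair_range_one]
  refine isTestBounded_sub_mul_prod_pair c d (by simp) (by simp) fun j => ?_
  rw [linearProd_range_one, Polynomial.coeff_X_add_one_pow]
  exact_mod_cast Nat.choose_le_middle j t

/-- Expand over the set `t` of players who tremble to `{c, d}`. Their factor gives a central
binomial weight; the others only contribute their mass. -/
theorem isTestBounded_sub_mul_prod_tremble [Fintype σ] {ι : Type*} (s : Finset ι)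
    {w : ι → σ → ℝ} (c d : σ) {ρ : ℝ} (hρ : 0 ≤ ρ) (hw : ∀ l ∈ s, ∀ j, 0 ≤ w l j)
    (hw1 : ∀ l ∈ s, ∑ j, w l j = 1 - 2 * ρ) :
    IsTestBounded ((X c - X d) * ∏ l ∈ s, (C ρ * (X c + X d) + linearForm (w l)))
      (meanMiddle s.card (2 * ρ)) := by
  classical
  have hb : ∀ t ∈ s.powerset, IsTestBounded
      ((X c - X d) * ((∏ _l ∈ t, C ρ * (X c + X d)) * ∏ l ∈ s \ t, linearForm (w l)))
      (ρ ^ t.card * ((1 - 2 * ρ) ^ (s.card - t.card) * (t.card.choose (t.card / 2) : ℝ))) := by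
    intro t ht
    have ht := Finset.mem_powerset.1 ht
    have h1 := ((isTestBounded_sub_mul_add_pow c d t.card).prod_linearForm_mul (s \ t)
      fun l hl => hw l (Finset.mem_sdiff.1 hl).1).C_mul (pow_nonneg hρ t.card)
    rw [Finset.prod_congr rfl fun l hl => hw1 l (Finset.mem_sdiff.1 hl).1, Finset.prod_const,
      Finset.card_sdiff_of_subset ht] at h1
    convert h1 using 1
    rw [Finset.prod_const, mul_pow, C_pow]
    ring
  rw [Finset.prod_add, Finset.mul_sum]
  refine (IsTestBounded.sum hb).mono (le_of_eq ?_)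
  rw [Finset.sum_powerset_apply_card
    (fun m => ρ ^ m * ((1 - 2 * ρ) ^ (s.card - m) * (m.choose (m / 2) : ℝ))), meanMiddle,
    binomialMean]
  refine Finset.sum_congr rfl fun m _ => ?_
  rw [binomialWeight, nsmul_eq_mul, mul_pow]
  field_simp

/-- The test that compares the numbers of players who take the actions `c` and `d`. -/
noncomputable def majorityTest (c d : σ) (m : σ →₀ ℕ) : ℝ := if m d < m c then 1 else 0

/-- The test that compares the number of players who take the action `c` with a threshold. -/
noncomputable def thresholdTest (c : σ) (j : ℕ) (m : σ →₀ ℕ) : ℝ := if j < m c then 1 else 0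

/-- Players who avoid `c` and `d` cannot influence the comparison. -/
theorem expect_majorityTest_prod_linearForm_mul [Fintype σ] {c d : σ} {w : σ → ℝ} (hc : w c = 0)
    (hd : w d = 0) (n : ℕ) (p : MvPolynomial σ ℝ) :
    expect (majorityTest c d) (linearForm w ^ n * p) =
      (∑ j, w j) ^ n * expect (majorityTest c d) p := by
  classical
  induction n with
  | zero => simp
  | succ n ih =>
    rw [pow_succ', mul_assoc, linearForm_mul, map_sum, pow_succ', mul_assoc, ← ih, Finset.sum_mul]
    refine Finset.sum_congr rfl fun j _ => ?_
    rw [expect_C_mul]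
    by_cases hj : w j = 0
    · simp [hj]
    have h1 : j ≠ c := fun h => hj (h ▸ hc)
    have h2 : j ≠ d := fun h => hj (h ▸ hd)
    rw [expect_X_mul]
    congr 3
    funext m
    simp [majorityTest, h1, h2]

theorem expect_majorityTest_sub_mul_add_pow {c d : σ} (hcd : c ≠ d) (t : ℕ) :
    expect (majorityTest c d) ((X c - X d) * (X c + X d) ^ t : MvPolynomial σ ℝ) =
      t.choose (t / 2) := by
  classical
  have hval : ∀ a b : ℕ, majorityTest c d (Finsupp.single c a + Finsupp.single d b) =
      if b < a then 1 else 0 := fun a b => by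
    simp [majorityTest, hcd, hcd.symm]
  rw [← prod_pair_range_one, expect_sub_mul_prod_pair]
  simp only [hval, Finset.card_range, linearProd_range_one, Polynomial.coeff_X_add_one_pow]
  -- The majority of `t + 1` votes changes only here, as `c` goes from `(t + 1) / 2` to one more
  -- vote.
  rw [Finset.sum_eq_single ((t + 1) / 2)]
  · rw [if_pos (by omega), if_neg (by omega), sub_zero, mul_one]
    norm_cast
    rw [← Nat.choose_symm (by omega : t / 2 ≤ t)]
    congr 1
    omega
  · intro i _ hi
    rcases Nat.lt_or_ge i ((t + 1) / 2) with h | h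
    · rw [if_neg (by omega), if_neg (by omega)]; simp
    · rw [if_pos (by omega), if_pos (by omega)]; simp
  · intro h
    exact absurd (Finset.mem_range.2 (by omega)) h

theorem expect_majorityTest_tremble [Fintype σ] {c d : σ} (hcd : c ≠ d) {w : σ → ℝ} (hc : w c = 0)
    (hd : w d = 0) {ρ : ℝ} (hw : ∑ j, w j = 1 - 2 * ρ) (N : ℕ) :
    expect (majorityTest c d) ((X c - X d) * (C ρ * (X c + X d) + linearForm w) ^ N) =
      meanMiddle N (2 * ρ) := by
  rw [add_pow, Finset.mul_sum, map_sum, meanMiddle, binomialMean]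
  refine Finset.sum_congr rfl fun t _ => ?_
  have : (X c - X d) * ((C ρ * (X c + X d)) ^ t * linearForm w ^ (N - t) *
      (N.choose t : MvPolynomial σ ℝ)) = C (N.choose t * ρ ^ t) *
        (linearForm w ^ (N - t) * ((X c - X d) * (X c + X d) ^ t)) := by
    rw [C_mul, C_pow, map_natCast, mul_pow]
    ring
  rw [this, expect_C_mul, expect_majorityTest_prod_linearForm_mul hc hd, hw,
    expect_majorityTest_sub_mul_add_pow hcd, binomialWeight, mul_pow]
  field_simp

theorem expect_thresholdTest_sub_mul_prod_pair {ι : Type*} (s : Finset ι) (p q : ι → ℝ) {c d : σ}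
    (hcd : c ≠ d) (j : ℕ) :
    expect (thresholdTest c j) ((X c - X d) * ∏ l ∈ s, (C (p l) * X c + C (q l) * X d)) =
      (linearProd s p q).coeff j := by
  classical
  have hval : ∀ a b : ℕ, thresholdTest c j (Finsupp.single c a + Finsupp.single d b) =
      if j < a then 1 else 0 := fun a b => by
    simp [thresholdTest, hcd]
  rw [expect_sub_mul_prod_pair]
  simp only [hval]
  rw [Finset.sum_eq_single j]
  · simp
  · intro i _ hi
    rcases Nat.lt_or_ge i j with h | h
    · rw [if_neg (by omega), if_neg (by omega)]; simp
    · rw [if_pos (by omega), if_pos (by omega)]; simp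
  · intro h
    rw [coeff_linearProd_eq_zero s p q (by simpa using h), zero_mul]

end

/-! ### From anonymous games to count vectors. -/

section
open MvPolynomial

/-- The numbers of opponents of player `i` who take each action. -/
noncomputable def countOthers {n k : ℕ} (i : Fin n) (b : Fin n → Fin k) : Fin k →₀ ℕ :=
  ∑ l ∈ Finset.univ.erase i, Finsupp.single (b l) 1

theorem actionCount_eq {n k : ℕ} (i : Fin n) (b : Fin n → Fin k) (j : Fin k) :
    actionCount b j = (if b i = j then 1 else 0) + countOthers i b j := by
  rw [actionCount, Finset.card_filter, ← Finset.add_sum_erase _ _ (Finset.mem_univ i),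
    countOthers, Finsupp.finsetSum_apply]
  simp only [Finsupp.single_apply]

theorem countOthers_eq_of_actionCount_eq {n k : ℕ} {i : Fin n} {a b : Fin n → Fin k}
    (hi : a i = b i) (h : ∀ j, actionCount a j = actionCount b j) :
    countOthers i a = countOthers i b := by
  ext j
  have := h j
  rw [actionCount_eq i, actionCount_eq i, hi] at this
  exact Nat.add_left_cancel this

theorem sum_prod_mul_eq_expect {n k : ℕ} (i : Fin n) (w : Fin n → Fin k → ℝ)
    (h : Fin k → (Fin k →₀ ℕ) → ℝ) :
    ∑ b : Fin n → Fin k, (∏ l, w l (b l)) * h (b i) (countOthers i b) =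
      ∑ j, w i j * expect (h j) (∏ l ∈ Finset.univ.erase i, linearForm (w l)) := by
  have key : ∀ j, w i j * expect (h j) (∏ l ∈ Finset.univ.erase i, linearForm (w l)) =
      ∑ b : Fin n → Fin k,
        if b i = j then (∏ l, w l (b l)) * h (b i) (countOthers i b) else 0 := by
    intro j
    -- The factor of player `i` is a constant supported on the action `j`, so `i` is not counted
    -- among the opponents.
    let f : Fin n → Fin k → MvPolynomial (Fin k) ℝ := fun l j' =>
      if l = i then (if j' = j then C (w i j) else 0) else C (w l j') * X j'
    have h1 : C (w i j) * ∏ l ∈ Finset.univ.erase i, linearForm (w l) = ∏ l, ∑ j', f l j' := by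
      rw [← Finset.mul_prod_erase _ _ (Finset.mem_univ i)]
      congr 1
      · simp [f]
      · refine Finset.prod_congr rfl fun l hl => ?_
        simp [f, linearForm, (Finset.mem_erase.1 hl).1]
    rw [← expect_C_mul, h1, Fintype.prod_sum, map_sum]
    refine Finset.sum_congr rfl fun b _ => ?_
    rw [← Finset.mul_prod_erase _ _ (Finset.mem_univ i)]
    have h2 : ∏ l ∈ Finset.univ.erase i, f l (b l) =
        monomial (countOthers i b) (∏ l ∈ Finset.univ.erase i, w l (b l)) := by
      rw [countOthers, monomial_sum_prod]
      refine Finset.prod_congr rfl fun l hl => ?_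
      simp only [f, (Finset.mem_erase.1 hl).1, if_false]
      rw [X, C_mul_monomial, mul_one]
    rw [h2]
    split_ifs with hb
    · simp only [f, hb, if_true]
      rw [← Finset.mul_prod_erase _ _ (Finset.mem_univ i), C_mul_monomial, expect_monomial, hb]
    · simp [f, hb]
  simp only [key]
  rw [Finset.sum_comm]
  exact Finset.sum_congr rfl fun b _ => by simp

theorem perturb_eq_expect {n k : ℕ} {δ : ℝ} {g : Payoff n k} {i : Fin n}
    {h : Fin k → (Fin k →₀ ℕ) → ℝ} (hg : ∀ b, g b i = h (b i) (countOthers i b))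
    (a : Fin n → Fin k) :
    perturb δ g a i = ∑ j, perturbedProb δ (a i) j *
      expect (h j) (∏ l ∈ Finset.univ.erase i, linearForm (perturbedProb δ (a l))) := by
  rw [← sum_prod_mul_eq_expect i (fun l => perturbedProb δ (a l)) h, perturb]
  simp only [hg]

theorem linearForm_perturbedProb_sub {k : ℕ} (δ : ℝ) (c d : Fin k) :
    linearForm (perturbedProb δ c) - linearForm (perturbedProb δ d) =
      C (1 - δ) * (X c - X d) := by
  have h : ∀ c : Fin k, linearForm (perturbedProb δ c) =
      C (1 - δ) * X c + ∑ j : Fin k, C (δ * (1 / (k : ℝ))) * X j := by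
    intro c
    have : ∀ j : Fin k, (C (perturbedProb δ c j) * X j : MvPolynomial (Fin k) ℝ) =
        (if j = c then C (1 - δ) * X j else 0) + C (δ * (1 / (k : ℝ))) * X j := by
      intro j
      rw [perturbedProb, C_add, add_mul]
      split_ifs <;> simp
    rw [linearForm, Finset.sum_congr rfl fun j _ => this j, Finset.sum_add_distrib]
    simp
  rw [h, h]
  ring

/-- Condition on the action of `i`. Only the factor of `m` differs, and its uniform part cancels. -/
theorem perturb_sub_perturb {n k : ℕ} {δ : ℝ} {g : Payoff n k} {i m : Fin n} (him : m ≠ i)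
    {h : Fin k → (Fin k →₀ ℕ) → ℝ} (hg : ∀ b, g b i = h (b i) (countOthers i b))
    {a b : Fin n → Fin k} (hab : ∀ l, l ≠ m → a l = b l) :
    perturb δ g a i - perturb δ g b i = (1 - δ) * ∑ j, perturbedProb δ (a i) j *
      expect (h j) ((X (a m) - X (b m)) *
        ∏ l ∈ (Finset.univ.erase i).erase m, linearForm (perturbedProb δ (a l))) := by
  have hm : m ∈ Finset.univ.erase i := by simp [him]
  rw [perturb_eq_expect hg, perturb_eq_expect hg, ← hab i him.symm, ← Finset.sum_sub_distrib,
    Finset.mul_sum]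
  refine Finset.sum_congr rfl fun j _ => ?_
  have hprod : ∏ l ∈ (Finset.univ.erase i).erase m, linearForm (perturbedProb δ (b l)) =
      ∏ l ∈ (Finset.univ.erase i).erase m, linearForm (perturbedProb δ (a l)) :=
    Finset.prod_congr rfl fun l hl => by rw [hab l (Finset.mem_erase.1 hl).1]
  rw [← Finset.mul_prod_erase _ _ hm, ← Finset.mul_prod_erase _ _ hm, hprod, ← mul_sub, ← map_sub, ← sub_mul, linearForm_perturbedProb_sub, mul_assoc, expect_C_mul]
  ring

theorem IsAnonymous.exists_eq_countOthers {n k : ℕ} {g : Payoff n k} (hg : IsGame g)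
    (hg' : IsAnonymous g) (i : Fin n) : ∃ h : Fin k → (Fin k →₀ ℕ) → ℝ,
      (∀ j m, h j m ∈ Set.Icc (0 : ℝ) 1) ∧ ∀ b, g b i = h (b i) (countOthers i b) := by
  classical
  -- Evaluate `g` at any profile with these data; counts that no profile realises get the default
  -- `0`.
  refine ⟨fun j m => if hx : ∃ b : Fin n → Fin k, b i = j ∧ countOthers i b = m
    then g hx.choose i else 0, fun j m => ?_, fun b => ?_⟩
  · dsimp only
    split_ifs with hx
    · exact hg _ _
    · simp
  · have hx : ∃ b' : Fin n → Fin k, b' i = b i ∧ countOthers i b' = countOthers i b := ⟨b, rfl, rfl⟩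
    dsimp only
    rw [dif_pos hx]
    refine hg' i _ _ hx.choose_spec.1.symm fun j => ?_
    rw [actionCount_eq i, actionCount_eq i, hx.choose_spec.1, hx.choose_spec.2]

theorem card_erase_erase {n : ℕ} {i m : Fin n} (h : m ≠ i) :
    ((Finset.univ.erase i).erase m).card = n - 2 := by
  rw [Finset.card_erase_of_mem (by simp [h]), Finset.card_erase_of_mem (Finset.mem_univ i),
    Finset.card_univ, Fintype.card_fin]
  omega

theorem worstLipschitz_le {n k : ℕ} (hn : 2 ≤ n) (hk : 2 ≤ k) {δ : ℝ} (h0 : 0 ≤ δ) (h1 : δ ≤ 1)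
    {K : ℝ} (hK : ∀ (s : Finset (Fin n)) (a : Fin n → Fin k) (c d : Fin k),
      s.card = n - 2 → c ≠ d → IsTestBounded
        ((X c - X d) * ∏ l ∈ s, linearForm (perturbedProb δ (a l))) K) :
    worstLipschitz n k δ ≤ (1 - δ) * K := by
  obtain ⟨g, hg, hg', hx⟩ := (isGreatest_worstLipschitz hn hk δ).1
  obtain ⟨i, a, b, hi, hab, hx'⟩ := (isGreatest_lipschitzConst hn hk (perturb δ g)).1
  obtain ⟨h, hh, hgh⟩ := hg'.exists_eq_countOthers hg i
  rw [hammingDist] at hab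
  obtain ⟨m, hm⟩ := Finset.card_eq_one.1 hab
  have hmem : ∀ l, a l ≠ b l ↔ l = m := fun l => by
    have := Finset.ext_iff.1 hm l
    simpa using this
  have him : m ≠ i := fun h => (hmem i).2 h.symm hi
  have hb := hK _ a (a m) (b m) (card_erase_erase him) ((hmem m).2 rfl)
  rw [hx, hx', perturb_sub_perturb him hgh fun l hl => not_not.1 fun hne => hl ((hmem l).1 hne),
    abs_mul, abs_of_nonneg (by linarith)]
  refine mul_le_mul_of_nonneg_left ((Finset.abs_sum_le_sum_abs _ _).trans ?_) (by linarith)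
  calc _ ≤ ∑ j, perturbedProb δ (a i) j * K := Finset.sum_le_sum fun j _ => by
        rw [abs_mul, abs_of_nonneg (perturbedProb_nonneg h0 h1 _ _)]
        exact mul_le_mul_of_nonneg_left (hb _ (hh j)) (perturbedProb_nonneg h0 h1 _ _)
    _ = K := by rw [← Finset.sum_mul, sum_perturbedProb, one_mul]

/-- The witness is the game whose payoff is `h` of the opponents' counts, regardless of the player's
own action. -/
theorem le_worstLipschitz {n k : ℕ} (hn : 2 ≤ n) (hk : 2 ≤ k) {δ : ℝ} {h : (Fin k →₀ ℕ) → ℝ}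
    (hh : ∀ m, h m ∈ Set.Icc (0 : ℝ) 1) {i m : Fin n} (him : m ≠ i) (a : Fin n → Fin k)
    {c d : Fin k} (hcd : c ≠ d) :
    (1 - δ) * expect h ((X c - X d) *
        ∏ l ∈ (Finset.univ.erase i).erase m, linearForm (perturbedProb δ (a l))) ≤
      worstLipschitz n k δ := by
  let g : Payoff n k := fun b i => h (countOthers i b)
  have hg : IsGame g := fun _ _ => hh _
  have hg' : IsAnonymous g := fun i a b hi hab => by
    simp only [g, countOthers_eq_of_actionCount_eq hi hab]
  refine le_trans ?_ ((isGreatest_worstLipschitz hn hk δ).2 ⟨g, hg, hg', rfl⟩)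
  refine le_trans ?_ ((isGreatest_lipschitzConst hn hk (perturb δ g)).2
    ⟨i, Function.update a m c, Function.update a m d, ?_, ?_, rfl⟩)
  · refine le_trans (le_of_eq ?_) (le_abs_self _)
    rw [perturb_sub_perturb him (h := fun _ => h) (fun b => rfl) fun l hl => by
      rw [Function.update_of_ne hl, Function.update_of_ne hl], ← Finset.sum_mul, sum_perturbedProb,
      one_mul, Function.update_self, Function.update_self]
    congr 3
    exact Finset.prod_congr rfl fun l hl => by
      rw [Function.update_of_ne (Finset.mem_erase.1 hl).1]
  · rw [Function.update_of_ne him.symm, Function.update_of_ne him.symm]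
  · have : (Finset.univ.filter
        (fun l => Function.update a m c l ≠ Function.update a m d l)) = {m} := by
      ext l
      by_cases h : l = m
      · subst h; simp [hcd]
      · simp [h]
    rw [hammingDist, this, Finset.card_singleton]

end

/-! ### The worst case: exact for `k ≥ 3`, two-sided bounds for `k = 2`. -/

section
open MvPolynomial

/-- The part of `perturbedProb δ a` that remains when a uniform tremble to `{c, d}` is removed. -/
noncomputable def residualProb {k : ℕ} (δ : ℝ) (c d a j : Fin k) : ℝ :=
  (if j = a then 1 - δ else 0) + if j = c ∨ j = d then 0 else δ / k

theorem residualProb_nonneg {k : ℕ} {δ : ℝ} (h0 : 0 ≤ δ) (h1 : δ ≤ 1) (c d a j : Fin k) :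
    0 ≤ residualProb δ c d a j := by
  have : 0 ≤ 1 - δ := by linarith
  unfold residualProb
  split_ifs <;> positivity

theorem perturbedProb_eq_add_residualProb {k : ℕ} (δ : ℝ) {c d : Fin k} (hcd : c ≠ d)
    (a j : Fin k) : perturbedProb δ a j =
      ((if j = c then δ / k else 0) + if j = d then δ / k else 0) + residualProb δ c d a j := by
  unfold perturbedProb residualProb
  by_cases hc : j = c
  · subst hc
    simp [hcd]
    ring
  · by_cases hd : j = d
    · subst hd
      simp [hcd.symm]
      ring
    · simp [hc, hd]
      ring

theorem sum_residualProb {k : ℕ} (δ : ℝ) {c d : Fin k} (hcd : c ≠ d) (a : Fin k) :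
    ∑ j, residualProb δ c d a j = 1 - 2 * (δ / k) := by
  have h := sum_perturbedProb δ a
  simp only [perturbedProb_eq_add_residualProb δ hcd, Finset.sum_add_distrib,
    Finset.sum_ite_eq', Finset.mem_univ, if_true] at h
  linarith

theorem linearForm_perturbedProb {k : ℕ} (δ : ℝ) {c d : Fin k} (hcd : c ≠ d) (a : Fin k) :
    linearForm (perturbedProb δ a) =
      C (δ / k) * (X c + X d) + linearForm (residualProb δ c d a) := by
  have h : ∀ j, (C (perturbedProb δ a j) * X j : MvPolynomial (Fin k) ℝ) =
      ((if j = c then C (δ / k) * X j else 0) + if j = d then C (δ / k) * X j else 0) +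
        C (residualProb δ c d a j) * X j := by
    intro j
    rw [perturbedProb_eq_add_residualProb δ hcd, C_add, C_add, add_mul, add_mul]
    congr 2 <;> split_ifs <;> simp
  rw [linearForm, Finset.sum_congr rfl fun j _ => h j, Finset.sum_add_distrib,
    Finset.sum_add_distrib, Finset.sum_ite_eq', Finset.sum_ite_eq']
  simp [linearForm, mul_add]

theorem worstLipschitz_le_meanMiddle {n k : ℕ} (hn : 2 ≤ n) (hk : 2 ≤ k) {δ : ℝ} (h0 : 0 ≤ δ)
    (h1 : δ ≤ 1) : worstLipschitz n k δ ≤ (1 - δ) * meanMiddle (n - 2) (2 * (δ / k)) := by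
  refine worstLipschitz_le hn hk h0 h1 fun s a c d hs hcd => ?_
  simp only [linearForm_perturbedProb δ hcd]
  rw [← hs]
  exact isTestBounded_sub_mul_prod_tremble s c d (by positivity)
    (fun l _ j => residualProb_nonneg h0 h1 _ _ _ _) fun l _ => sum_residualProb δ hcd _

/-- All `n - 2` others choose a third action `e`, so the residual law puts nothing on `c` or `d` and
the majority test sees only the trembles. This is where `k ≥ 3` enters. -/
theorem meanMiddle_le_worstLipschitz {n k : ℕ} (hn : 2 ≤ n) (hk : 3 ≤ k) (δ : ℝ) :
    (1 - δ) * meanMiddle (n - 2) (2 * (δ / k)) ≤ worstLipschitz n k δ := by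
  let c : Fin k := ⟨0, by omega⟩
  let d : Fin k := ⟨1, by omega⟩
  let e : Fin k := ⟨2, by omega⟩
  have hcd : c ≠ d := by simp [c, d]
  have hce : c ≠ e := by simp [c, e]
  have hde : d ≠ e := by simp [d, e]
  have him : (⟨1, by omega⟩ : Fin n) ≠ ⟨0, by omega⟩ := by simp
  have h := le_worstLipschitz hn (by omega : 2 ≤ k) (δ := δ) (h := majorityTest c d)
    (fun m => by unfold majorityTest; split_ifs <;> simp) him (fun _ => e) hcd
  rwa [Finset.prod_const, card_erase_erase him, linearForm_perturbedProb δ hcd,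
    expect_majorityTest_tremble hcd (by simp [residualProb, hce]) (by simp [residualProb, hde])
      (sum_residualProb δ hcd e)] at h

theorem worstLipschitz_eq_meanMiddle {n k : ℕ} (hn : 2 ≤ n) (hk : 3 ≤ k) {δ : ℝ} (h0 : 0 ≤ δ)
    (h1 : δ ≤ 1) : worstLipschitz n k δ = (1 - δ) * meanMiddle (n - 2) (2 * (δ / k)) :=
  le_antisymm (worstLipschitz_le_meanMiddle hn (by omega) h0 h1)
    (meanMiddle_le_worstLipschitz hn hk δ)

theorem linearForm_fin_two {c d : Fin 2} (hcd : c ≠ d) (w : Fin 2 → ℝ) :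
    linearForm w = C (w c) * X c + C (w d) * X d := by
  have : (Finset.univ : Finset (Fin 2)) = {c, d} :=
    (Finset.eq_univ_of_card _ (by rw [Finset.card_pair hcd]; rfl)).symm
  rw [linearForm, this, Finset.sum_pair hcd]

theorem perturbedProb_self_two (δ : ℝ) (c : Fin 2) : perturbedProb δ c c = 1 - δ / 2 := by
  simp [perturbedProb]
  ring

theorem perturbedProb_ne_two (δ : ℝ) {a c : Fin 2} (h : c ≠ a) : perturbedProb δ a c = δ / 2 := by
  simp [perturbedProb, h]
  ring

theorem worstLipschitz_two_le {n : ℕ} (hn : 2 ≤ n) {δ : ℝ} (h0 : 0 ≤ δ) (h1 : δ ≤ 1) :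
    worstLipschitz n 2 δ ≤ (1 - δ) *
      √(meanCentral ((n - 2) / 2) (4 * (1 - δ / 2) * (δ / 2)) *
        meanCentral (n - 2 - (n - 2) / 2) (4 * (1 - δ / 2) * (δ / 2))) := by
  refine worstLipschitz_le hn le_rfl h0 h1 fun s a c d hs hcd => ?_
  simp only [linearForm_fin_two hcd]
  refine isTestBounded_sub_mul_prod_pair c d (fun l _ => perturbedProb_nonneg h0 h1 _ _)
    (fun l _ => perturbedProb_nonneg h0 h1 _ _) fun j => Real.le_sqrt_of_sq_le ?_
  rw [← hs]
  refine sq_coeff_linearProd_le s (by ring) (fun l _ => ?_) j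
  by_cases h : c = a l
  · left
    rw [← h, perturbedProb_self_two, perturbedProb_ne_two δ hcd.symm]
    exact ⟨rfl, rfl⟩
  · right
    have hd : d = a l := by omega
    rw [perturbedProb_ne_two δ h, hd, perturbedProb_self_two]
    exact ⟨rfl, rfl⟩

/-- Half of the others choose `0` and half `1`; the threshold test then reads off one coefficient,
and the threshold `j` is the one with a large coefficient. -/
theorem le_worstLipschitz_two {n : ℕ} (hn : 2 ≤ n) {δ : ℝ} (h0 : 0 ≤ δ) (h1 : δ ≤ 1) :
    (1 - δ) * meanCentral (n - 2 - (n - 2) / 2) (4 * (1 - δ / 2) * (δ / 2)) ≤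
      worstLipschitz n 2 δ := by
  obtain ⟨j, hj⟩ := exists_meanCentral_le_coeff (p := 1 - δ / 2) (q := δ / 2) (by linarith)
    (by linarith) (by ring) (n - 2)
  refine (mul_le_mul_of_nonneg_left hj (by linarith)).trans ?_
  have hcd : (0 : Fin 2) ≠ 1 := by simp
  have him : (⟨1, by omega⟩ : Fin n) ≠ ⟨0, by omega⟩ := by simp
  set s := ((Finset.univ : Finset (Fin n)).erase ⟨0, by omega⟩).erase ⟨1, by omega⟩ with hs
  have hc : s.card = n - 2 := card_erase_erase him
  obtain ⟨t, hts, ht⟩ := Finset.exists_subset_card_eq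
    (by rw [hc]; omega : n - 2 - (n - 2) / 2 ≤ s.card)
  let a : Fin n → Fin 2 := fun l => if l ∈ t then 0 else 1
  have h := le_worstLipschitz hn le_rfl (δ := δ) (h := thresholdTest 0 j)
    (fun m => by unfold thresholdTest; split_ifs <;> simp) him a hcd
  rw [← hs] at h
  simp only [linearForm_fin_two hcd] at h
  rw [expect_thresholdTest_sub_mul_prod_pair _ _ _ hcd] at h
  refine le_trans (le_of_eq ?_) h
  congr 2
  have hst : (s \ t).card = (n - 2) / 2 := by
    rw [Finset.card_sdiff_of_subset hts, hc, ht]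
    omega
  rw [linearProd, ← Finset.prod_sdiff hts, mul_comm, ← ht, ← hst, ← Finset.prod_const,
    ← Finset.prod_const]
  congr 1
  · refine Finset.prod_congr rfl fun l hl => ?_
    have : a l = 1 := if_neg (Finset.mem_sdiff.1 hl).2
    rw [this, perturbedProb_self_two, perturbedProb_ne_two δ hcd]
  · refine Finset.prod_congr rfl fun l hl => ?_
    have : a l = 0 := if_pos hl
    rw [this, perturbedProb_self_two, perturbedProb_ne_two δ hcd.symm]

end

/-! ### Explicit error bounds and the limit. -/

/-- The bounds put `Q²` between `1 - 4 / (y + 4)` and `1 + 21 / (y - 1)`, within `ε` of 1 for such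
`y`; and `|Q - 1| ≤ |Q² - 1|` for `Q ≥ 0`. -/
theorem abs_sub_one_lt_of_sq_bounds {ε y Q : ℝ} (hε : 0 < ε) (hy : 3 + 22 / ε ≤ y) (hQ : 0 ≤ Q)
    (h1 : y / (y + 4) ≤ Q ^ 2) (h2 : Q ^ 2 ≤ (y + 20) / (y - 1)) : |Q - 1| < ε := by
  have h0 : 0 < 22 / ε := by positivity
  have hy3 : 3 ≤ y := by linarith
  have hey : 22 ≤ ε * (y - 3) := by
    have := (div_le_iff₀ hε).1 (by linarith : 22 / ε ≤ y - 3)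
    linarith
  rw [div_le_iff₀ (by linarith)] at h1
  rw [le_div_iff₀ (by linarith)] at h2
  rw [abs_lt]
  constructor
  · by_contra hc
    push Not at hc
    have h3 : Q ^ 2 ≤ 1 - ε := by nlinarith
    nlinarith
  · by_contra hc
    push Not at hc
    have h3 : 1 + ε ≤ Q ^ 2 := by nlinarith
    nlinarith

theorem meanMiddle_asymptotic_bounds {n : ℕ} {r y : ℝ} (hn : 2 ≤ n) (hr : 0 < r) (hr1 : r ≤ 1)
    (hy : y = n * r) (hy3 : 3 ≤ y) :
    y / (y + 4) ≤ Real.pi * y / 2 * meanMiddle (n - 2) r ^ 2 ∧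
      Real.pi * y / 2 * meanMiddle (n - 2) r ^ 2 ≤ (y + 20) / (y - 1) := by
  have hpi := Real.pi_pos
  have hn' : ((n - 2 : ℕ) : ℝ) = n - 2 := by push_cast [hn]; rfl
  have hn2 : (2 : ℝ) ≤ n := by exact_mod_cast hn
  have hy0 : 0 < y := by linarith
  have h1 := le_sq_meanMiddle (N := n - 2) hr.le hr1
  have h2 := sq_meanMiddle_le (N := n - 2) hr hr1
  rw [hn'] at h1 h2
  constructor
  · refine le_trans ?_ (mul_le_mul_of_nonneg_left h1 (by positivity))
    have : Real.pi * y / 2 * (2 / Real.pi / ((n - 2) * r + 2)) = y / ((n - 2) * r + 2) := by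
      field_simp
    rw [this]
    refine div_le_div_of_nonneg_left hy0.le (by nlinarith) (by nlinarith)
  · refine (mul_le_mul_of_nonneg_left h2 (by positivity)).trans ?_
    have hr' : (n : ℝ) - 1 ≠ 0 := by linarith
    have : Real.pi * y / 2 * (2 / Real.pi * (1 / (((n : ℝ) - 2 + 1) * r) +
        6 * (1 / (((n : ℝ) - 2 + 1) * (n - 2 + 2) * r ^ 2)))) = (y + 6) / ((n - 1) * r) := by
      rw [show (n : ℝ) - 2 + 1 = n - 1 by ring, show (n : ℝ) - 2 + 2 = n by ring, hy]
      have : (n : ℝ) ≠ 0 := by linarith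
      field_simp
    rw [this]
    exact div_le_div₀ (by linarith) (by linarith) (by linarith) (by nlinarith)

theorem meanCentral_asymptotic_bounds {n : ℕ} {s y : ℝ} (hn : 2 ≤ n) (hs : 0 < s) (hs1 : s ≤ 1)
    (hy : y = n * s) (hy3 : 3 ≤ y) :
    y / (y + 4) ≤ Real.pi * y / 2 * meanCentral (n - 2 - (n - 2) / 2) s ^ 2 ∧
      Real.pi * y / 2 * (meanCentral ((n - 2) / 2) s * meanCentral (n - 2 - (n - 2) / 2) s) ≤
        (y + 20) / (y - 1) := by
  have hpi := Real.pi_pos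
  have hn2 : (2 : ℝ) ≤ n := by exact_mod_cast hn
  have hy0 : 0 < y := by linarith
  constructor
  · refine le_trans ?_ (mul_le_mul_of_nonneg_left (le_sq_meanCentral hs.le hs1) (by positivity))
    have hm : 2 * ((n - 2 - (n - 2) / 2 : ℕ) : ℝ) ≤ n := by
      exact_mod_cast (by omega : 2 * (n - 2 - (n - 2) / 2) ≤ n)
    set m := ((n - 2 - (n - 2) / 2 : ℕ) : ℝ) with hm'
    have hm0 : 0 ≤ m := Nat.cast_nonneg _
    have : Real.pi * y / 2 * (1 / Real.pi / (m * s + 2)) = y / (2 * m * s + 4) := by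
      field_simp
      ring
    rw [this]
    refine div_le_div_of_nonneg_left hy0.le (by positivity) (by nlinarith)
  -- Both halves of `n - 2` satisfy `n ≤ 2m + 3`, that is `m + 1 ≥ (n - 1) / 2`.
  · have hB : ∀ m : ℕ, n ≤ 2 * m + 3 →
        meanCentral m s ^ 2 ≤ 1 / Real.pi * (2 / (y - 1) + 24 / (y - 1) ^ 2) := by
      intro m hm
      have hm' : (n : ℝ) ≤ 2 * m + 3 := by exact_mod_cast hm
      have hz : (y - 1) / 2 ≤ (m + 1) * s := by nlinarith
      refine (sq_meanCentral_le hs hs1).trans ?_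
      refine mul_le_mul_of_nonneg_left ?_ (by positivity)
      have hz2 : ((y - 1) / 2) ^ 2 ≤ (m + 1) * (m + 2) * s ^ 2 := by
        calc ((y - 1) / 2) ^ 2 ≤ ((m + 1) * s) ^ 2 := by
              exact pow_le_pow_left₀ (by linarith) hz 2
          _ = (m + 1) * (m + 1) * s ^ 2 := by ring
          _ ≤ _ := by gcongr; norm_num
      have e1 : 2 / (y - 1) = 1 / ((y - 1) / 2) := by rw [one_div_div]
      have e2 : 24 / (y - 1) ^ 2 = 6 * (1 / ((y - 1) / 2) ^ 2) := by
        rw [div_pow, one_div_div]; ring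
      have hy1 : 0 < (y - 1) / 2 := by linarith
      rw [e1, e2]
      gcongr
    have h1 := hB ((n - 2) / 2) (by omega)
    have h2 := hB (n - 2 - (n - 2) / 2) (by omega)
    have h3 : meanCentral ((n - 2) / 2) s * meanCentral (n - 2 - (n - 2) / 2) s ≤
        1 / Real.pi * (2 / (y - 1) + 24 / (y - 1) ^ 2) := by
      nlinarith [sq_nonneg (meanCentral ((n - 2) / 2) s - meanCentral (n - 2 - (n - 2) / 2) s)]
    refine (mul_le_mul_of_nonneg_left h3 (by positivity)).trans ?_
    have hy1 : 0 < y - 1 := by linarith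
    have : Real.pi * y / 2 * (1 / Real.pi * (2 / (y - 1) + 24 / (y - 1) ^ 2)) =
        y * (y + 11) / (y - 1) / (y - 1) := by
      field_simp
      ring
    rw [this]
    refine div_le_div_of_nonneg_right ?_ hy1.le
    rw [div_le_iff₀ hy1]
    nlinarith

theorem theorem3 :
    (∀ ε : ℝ, 0 < ε → ∃ M : ℝ, ∀ (n k : ℕ) (δ : ℝ), 3 ≤ k → 0 < δ → δ < 1 →
      M ≤ (n : ℝ) * δ / (k : ℝ) →
        |(1 - δ)⁻¹ * Real.sqrt (Real.pi * (n : ℝ) * δ / (k : ℝ)) * worstLipschitz n k δ - 1| < ε) ∧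
    (∀ ε : ℝ, 0 < ε → ∃ M : ℝ, ∀ (n : ℕ) (δ : ℝ), 0 < δ → δ < 1 →
      M ≤ (n : ℝ) * δ →
        |(1 - δ)⁻¹ * Real.sqrt (Real.pi * (n : ℝ) * δ * (1 - δ / 2)) * worstLipschitz n 2 δ - 1|
          < ε) := by
  have hpi := Real.pi_pos
  refine ⟨fun ε hε => ⟨3 + 22 / ε, fun n k δ hk h0 h1 hM => ?_⟩,
    fun ε hε => ⟨3 + 22 / ε, fun n δ h0 h1 hM => ?_⟩⟩
  · have hε' : 0 < 22 / ε := by positivity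
    have hk' : (3 : ℝ) ≤ k := by exact_mod_cast hk
    set r := 2 * (δ / k) with hr
    have hr0 : 0 < r := by positivity
    have hr1 : r ≤ 1 := by
      rw [hr, ← mul_div_assoc, div_le_one (by positivity)]
      linarith
    -- Here `n * r` is twice `n * δ / k`, so the same threshold `M` serves.
    have hy : 3 + 22 / ε ≤ n * r := by
      have : (n : ℝ) * r = 2 * (n * δ / k) := by rw [hr]; ring
      rw [this]
      linarith
    have hn : 2 ≤ n := by
      have : (2 : ℝ) ≤ n := by nlinarith [Nat.cast_nonneg (α := ℝ) n]
      exact_mod_cast this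
    have hδ : 1 - δ ≠ 0 := by linarith
    rw [worstLipschitz_eq_meanMiddle hn hk h0.le h1.le]
    have hV := meanMiddle_nonneg (N := n - 2) hr0.le hr1
    have hQ : (1 - δ)⁻¹ * √(Real.pi * n * δ / k) * ((1 - δ) * meanMiddle (n - 2) r) =
        √(Real.pi * n * δ / k) * meanMiddle (n - 2) r := by
      field_simp
    have hQ2 : (√(Real.pi * n * δ / k) * meanMiddle (n - 2) r) ^ 2 =
        Real.pi * (n * r) / 2 * meanMiddle (n - 2) r ^ 2 := by
      rw [mul_pow, Real.sq_sqrt (by positivity), hr]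
      ring
    obtain ⟨hl, hu⟩ := meanMiddle_asymptotic_bounds hn hr0 hr1 rfl (by linarith)
    rw [hQ]
    exact abs_sub_one_lt_of_sq_bounds hε hy (by positivity) (hQ2 ▸ hl) (hQ2 ▸ hu)
  · have hε' : 0 < 22 / ε := by positivity
    set s := 4 * (1 - δ / 2) * (δ / 2) with hs
    have hs0 : 0 < s := mul_pos (by linarith) (by linarith)
    have hs1 : s ≤ 1 := by nlinarith [sq_nonneg (1 - δ)]
    -- Since `s = δ (2 - δ) ≥ δ`, the threshold for `n * δ` passes to `n * s`.
    have hy : 3 + 22 / ε ≤ n * s := by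
      have : (n : ℝ) * s = n * δ * (2 - δ) := by rw [hs]; ring
      rw [this]
      nlinarith
    have hn : 2 ≤ n := by
      have : (2 : ℝ) ≤ n := by nlinarith [Nat.cast_nonneg (α := ℝ) n]
      exact_mod_cast this
    have hδ : 0 < 1 - δ := by linarith
    obtain ⟨hl, hu⟩ := meanCentral_asymptotic_bounds hn hs0 hs1 rfl (by linarith)
    have hlow := le_worstLipschitz_two hn h0.le h1.le
    have hupp := worstLipschitz_two_le hn h0.le h1.le
    rw [← hs] at hlow hupp
    have hΛ := meanCentral_nonneg (N := n - 2 - (n - 2) / 2) hs0.le hs1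
    have hΛ' := meanCentral_nonneg (N := (n - 2) / 2) hs0.le hs1
    obtain ⟨V, hV⟩ : ∃ V, worstLipschitz n 2 δ = (1 - δ) * V :=
      ⟨(1 - δ)⁻¹ * worstLipschitz n 2 δ, by field_simp⟩
    rw [hV] at hlow hupp
    have hlow := le_of_mul_le_mul_left hlow hδ
    have hupp := le_of_mul_le_mul_left hupp hδ
    have hV0 : 0 ≤ V := hΛ.trans hlow
    have hlow2 := pow_le_pow_left₀ hΛ hlow 2
    have hupp2 := pow_le_pow_left₀ hV0 hupp 2
    rw [Real.sq_sqrt (mul_nonneg hΛ' hΛ)] at hupp2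
    have hQ : (1 - δ)⁻¹ * √(Real.pi * n * δ * (1 - δ / 2)) * ((1 - δ) * V) =
        √(Real.pi * n * δ * (1 - δ / 2)) * V := by
      field_simp
    have hδ2 : 0 ≤ 1 - δ / 2 := by linarith
    have hQ2 : (√(Real.pi * n * δ * (1 - δ / 2)) * V) ^ 2 =
        Real.pi * (n * s) / 2 * V ^ 2 := by
      rw [mul_pow, Real.sq_sqrt (by positivity), hs]
      ring
    rw [hV, hQ]
    refine abs_sub_one_lt_of_sq_bounds hε hy (by positivity) ?_ ?_ <;> rw [hQ2]
    · exact hl.trans (mul_le_mul_of_nonneg_left hlow2 (by positivity))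
    · exact (mul_le_mul_of_nonneg_left hupp2 (by positivity)).trans hu
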